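/- **Setting.** Let $d_1,d_2,r\ge 0$ be integers and let $\Omega_1\subset\mathbb R^{d_1}$, $\Omega_2\subset\mathbb R^{d_2}$ be open. For $i=1,2$ and every $\sigma\ge 0$ let $M_{i,\sigma}=m_{i,\sigma}(\Omega_i)\subset\mathbb R^{d_i+1}$ be a surface parametrized by an injective $C^1$ immersion $m_{i,\sigma}:\Omega_i\to\mathbb R^{d_i+1}$, with surface measure $ds=\sqrt{\det(\partial m^T\partial m)}\,d\zeta$. Write $M_i=M_{i,0}$, $m_i=m_{i,0}$. The surface gradient of a function $v$ on a patch $M=m(\Omega)$ is defined by $(\nabla_M v)\circ m=\partial(v\circ m)\,(\partial m)^\dagger$, with a weak derivative $\partial$ on $\Omega$ and $(\partial m)^\dagger=(\partial m^T\partial m)^{-1}\partial m^T$. Let $P_\tau(x)$ and $P_n(x)$ be the orthogonal projections of $\mathbb R^{d+1}$ onto the tangent space and the normal space of $M$ at $x$ (written $P_{\tau,\sigma}$, $P_{n,\sigma}$ for $M=M_{1,\sigma}$). The Hilbert space $\mathcal H^1(M)$ consists of the vector fields $u\in L^2(M,\mathbb R^{d+1})$ for which $P_\tau u$ and $P_nu$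 have weak surface gradients and $U:=P_\tau\nabla_M(P_\tau u)+P_n\nabla_M(P_nu)\in L^2(M)$; its norm is $\|u\|_{\mathcal H^1(M)}^2=\|u\|_{L^2(M)}^2+\|U\|_{L^2(M)}^2$, with the Frobenius norm for matrices. Assume that for every $\sigma\ge0$ $$m_{1,\sigma}\in W^{2,\infty}(\Omega_1,\mathbb R^{d_1+1}),\qquad m_{1,\sigma}^{-1}\in W^{2,\infty}(M_{1,\sigma},\mathbb R^{d_1}),$$ and that $$\gamma_1(\sigma):=\|m_{1,\sigma}-m_1\|_{W^{2,\infty}(\Omega_1)}\to0\qquad(\sigma\to0^+).$$ Let $T_{i,\sigma}v=v\circ m_i\circ m_{i,\sigma}^{-1}$, which takes functions on $M_i$ to functions on $M_{i,\sigma}$, and let $T_{i,\sigma}^{-1}w=w\circ m_{i,\sigma}\circ m_i^{-1}$; under these assumptions $T_{1,\sigma}$ maps $\mathcal H^1(M_1)$ into $\mathcal H^1(M_{1,\sigma})$. Let $F_\sigma:\mathcal H^1(M_{1,\sigma})\to L^2(M_{2,\sigma},\mathbb R^r)$, $\sigma\ge0$, be bounded linear operators, put $F=F_0$, and assume that $$\rho(\sigma):=\big\|T_{2,\sigma}^{-1}F_\sigma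 T_{1,\sigma}-F\big\|_{\mathcal H^1(M_1)\to L^2(M_2,\mathbb R^r)}\to0\qquad(\sigma\to0^+).$$ **Claim.** Let $$\rho^a(\sigma):=\left\|\binom{T_{2,\sigma}^{-1}F_\sigma T_{1,\sigma}}{T_{1,\sigma}^{-1}P_{n,\sigma}T_{1,\sigma}}-\binom{F}{P_n}\right\|_{\mathcal H^1(M_1)\to L^2(M_2,\mathbb R^r)\times L^2(M_1,\mathbb R^{d_1+1})},$$ where the product has the norm $(\|a\|^2+\|b\|^2)^{1/2}$. Then $\rho^a(\sigma)\to0$ as $\sigma\to0^+$. More precisely, $\rho^a(\sigma)=\mathcal O(\rho(\sigma)+\gamma_1(\sigma))$ as $\sigma\to0^+$: there is a constant $C$ with $\rho^a(\sigma)\le C\,(\rho(\sigma)+\gamma_1(\sigma))$ for all sufficiently small $\sigma>0$. -/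

import Mathlib

open MeasureTheory Filter Topology Set TopologicalSpace
open scoped ENNReal NNReal ContDiff

noncomputable section

namespace SurfacePert

/-- The Euclidean space `ℝ^n`. -/
abbrev E (n : ℕ) := EuclideanSpace ℝ (Fin n)

instance continuousSMul_E (n : ℕ) : ContinuousSMul ℝ (E n) := inferInstance

instance summable_E (n : ℕ) : HasSummableGeomSeries (E n →L[ℝ] E n) := inferInstance

instance secondCountable_E (n : ℕ) : SecondCountableTopology (E n) := inferInstance

/-- `f'` is the weak derivative of `f` on `Ω`; both are locally integrable. -/
structure HasWeakDeriv {d : ℕ} {V : Type*} [NormedAddCommGroup V] [NormedSpace ℝ V]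
    (Ω : Opens (E d)) (f : E d → V) (f' : E d → E d →L[ℝ] V) : Prop where
  locInt : LocallyIntegrableOn f Ω
  locInt' : LocallyIntegrableOn f' Ω
  integral_eq : ∀ φ : E d → ℝ, ContDiff ℝ ∞ φ → HasCompactSupport φ → tsupport φ ⊆ Ω →
    ∀ v : E d, ∫ ζ, (fderiv ℝ φ ζ v) • f ζ = - ∫ ζ, φ ζ • f' ζ v

section
variable {d : ℕ} {V W : Type*} [NormedAddCommGroup V] [NormedSpace ℝ V]
  [NormedAddCommGroup W] [NormedSpace ℝ W] {Ω : Opens (E d)}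
  {f g : E d → V} {f' g' : E d → E d →L[ℝ] V}

/-- A locally integrable function on `Ω` times a continuous function with compact support in `Ω` is
integrable. -/
theorem integrable_smul {c : E d → ℝ} (hc : Continuous c) (hcs : HasCompactSupport c)
    (hs : tsupport c ⊆ Ω) (hf : LocallyIntegrableOn f Ω) : Integrable fun ζ => c ζ • f ζ := by
  have h1 : IntegrableOn f (tsupport c) := hf.integrableOn_compact_subset hs hcs.isCompact
  have h2 : IntegrableOn (fun ζ => c ζ • f ζ) (tsupport c) :=
    h1.continuousOn_smul hc.continuousOn hcs.isCompact
  rw [integrableOn_iff_integrable_of_support_subset] at h2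
  · exact h2
  · intro ζ hζ
    by_contra h
    exact hζ (by simp [image_eq_zero_of_notMem_tsupport h])

theorem locInt_add {U : Type*} [NormedAddCommGroup U] {a b : E d → U}
    (ha : LocallyIntegrableOn a Ω) (hb : LocallyIntegrableOn b Ω) :
    LocallyIntegrableOn (fun ζ => a ζ + b ζ) Ω := ha.add hb

theorem locInt_zero {U : Type*} [NormedAddCommGroup U] :
    LocallyIntegrableOn (fun _ : E d => (0 : U)) Ω :=
  (integrable_zero _ _ _).locallyIntegrable.locallyIntegrableOn _

theorem integrable_of_support {U : Type*} [NormedAddCommGroup U] {a : E d → U} {s : Set (E d)}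
    (ha : IntegrableOn a s) (h : Function.support a ⊆ s) : Integrable a :=
  (integrableOn_iff_integrable_of_support_subset h).1 ha

theorem fderiv_test {φ : E d → ℝ} (h : ContDiff ℝ ∞ φ) (hs : HasCompactSupport φ) (v : E d) :
    Continuous (fun ζ => fderiv ℝ φ ζ v) ∧ HasCompactSupport (fun ζ => fderiv ℝ φ ζ v) ∧
      tsupport (fun ζ => fderiv ℝ φ ζ v) ⊆ tsupport φ := by
  refine ⟨(h.continuous_fderiv (by simp)).clm_apply continuous_const, ?_, ?_⟩
  · exact hs.fderiv_apply (𝕜 := ℝ) v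
  · exact tsupport_fderiv_apply_subset ℝ v

theorem locInt_apply (hf : LocallyIntegrableOn f' Ω) (v : E d) :
    LocallyIntegrableOn (fun ζ => f' ζ v) Ω := by
  intro x hx
  obtain ⟨s, hs, h⟩ := hf x hx
  exact ⟨s, hs, h.apply_continuousLinearMap v⟩

namespace HasWeakDeriv

theorem int_left (h : HasWeakDeriv Ω f f') {φ : E d → ℝ} (hφ : ContDiff ℝ ∞ φ)
    (hc : HasCompactSupport φ) (hs : tsupport φ ⊆ Ω) (v : E d) :
    Integrable fun ζ => (fderiv ℝ φ ζ v) • f ζ := by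
  obtain ⟨h1, h2, h3⟩ := fderiv_test hφ hc v
  exact integrable_smul h1 h2 (h3.trans hs) h.locInt

theorem int_right (h : HasWeakDeriv Ω f f') {φ : E d → ℝ} (hφ : ContDiff ℝ ∞ φ)
    (hc : HasCompactSupport φ) (hs : tsupport φ ⊆ Ω) (v : E d) :
    Integrable fun ζ => φ ζ • f' ζ v :=
  integrable_smul hφ.continuous hc hs (locInt_apply h.locInt' v)

theorem add (hf : HasWeakDeriv Ω f f') (hg : HasWeakDeriv Ω g g') :
    HasWeakDeriv Ω (fun ζ => f ζ + g ζ) (fun ζ => f' ζ + g' ζ) := by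
  refine ⟨locInt_add hf.locInt hg.locInt, locInt_add hf.locInt' hg.locInt', fun φ h1 h2 h3 v => ?_⟩
  simp only [add_apply, smul_add]
  rw [integral_add (hf.int_left h1 h2 h3 v) (hg.int_left h1 h2 h3 v),
    integral_add (hf.int_right h1 h2 h3 v) (hg.int_right h1 h2 h3 v),
    hf.integral_eq φ h1 h2 h3 v, hg.integral_eq φ h1 h2 h3 v, neg_add]

theorem clm_comp [CompleteSpace V] [CompleteSpace W] (hf : HasWeakDeriv Ω f f') (L : V →L[ℝ] W) :
    HasWeakDeriv Ω (fun ζ => L (f ζ)) (fun ζ => L ∘L f' ζ) := by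
  refine ⟨?_, ?_, fun φ h1 h2 h3 v => ?_⟩
  · intro x hx
    obtain ⟨s, hs, h⟩ := hf.locInt x hx
    exact ⟨s, hs, L.integrable_comp h⟩
  · intro x hx
    obtain ⟨s, hs, h⟩ := hf.locInt' x hx
    exact ⟨s, hs, ((ContinuousLinearMap.compL ℝ (E d) V W) L).integrable_comp h⟩
  · have := congrArg L (hf.integral_eq φ h1 h2 h3 v)
    rw [map_neg, ← L.integral_comp_comm (hf.int_left h1 h2 h3 v),
      ← L.integral_comp_comm (hf.int_right h1 h2 h3 v)] at this
    simpa using this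

theorem const_smul [CompleteSpace V] (hf : HasWeakDeriv Ω f f') (c : ℝ) :
    HasWeakDeriv Ω (fun ζ => c • f ζ) (fun ζ => c • f' ζ) := by
  have := hf.clm_comp (c • ContinuousLinearMap.id ℝ V)
  convert this using 2
  · simp
  · ext v
    simp

theorem zero : HasWeakDeriv Ω (fun _ => (0 : V)) (fun _ => 0) := by
  refine ⟨locInt_zero, locInt_zero, fun φ h1 h2 h3 v => ?_⟩
  simp

theorem sum [CompleteSpace V] {ι : Type*} (s : Finset ι) {F : ι → E d → V}
    {F' : ι → E d → E d →L[ℝ] V} (h : ∀ i ∈ s, HasWeakDeriv Ω (F i) (F' i)) :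
    HasWeakDeriv Ω (fun ζ => ∑ i ∈ s, F i ζ) (fun ζ => ∑ i ∈ s, F' i ζ) := by
  classical
  induction s using Finset.induction_on with
  | empty => simpa using zero
  | insert a s ha ih =>
    simp only [Finset.sum_insert ha]
    exact (h a (by simp)).add (ih fun i hi => h i (by simp [hi]))

theorem congr (hf : HasWeakDeriv Ω f f')
    (h : f =ᵐ[volume.restrict (Ω : Set (E d))] g)
    (h' : f' =ᵐ[volume.restrict (Ω : Set (E d))] g') : HasWeakDeriv Ω g g' := by
  have hm : MeasurableSet (Ω : Set (E d)) := Ω.isOpen.measurableSet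
  have key : ∀ {U : Type _} [NormedAddCommGroup U] {a b : E d → U},
      a =ᵐ[volume.restrict (Ω : Set (E d))] b → LocallyIntegrableOn a Ω →
        LocallyIntegrableOn b Ω := by
    intro U _ a b hab ha x hx
    obtain ⟨s, hs, hi⟩ := ha x hx
    refine ⟨s ∩ Ω, Filter.inter_mem hs self_mem_nhdsWithin, ?_⟩
    refine (hi.mono_set inter_subset_left).congr ?_
    exact ae_restrict_of_ae_restrict_of_subset inter_subset_right hab
  refine ⟨key h hf.locInt, key h' hf.locInt', fun φ h1 h2 h3 v => ?_⟩
  have e := hf.integral_eq φ h1 h2 h3 v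
  rw [EventuallyEq, ae_restrict_iff' hm] at h h'
  rw [← integral_congr_ae (f := fun ζ => (fderiv ℝ φ ζ v) • f ζ), e,
    integral_congr_ae (f := fun ζ => φ ζ • f' ζ v)]
  · filter_upwards [h'] with ζ hζ
    by_cases hz : ζ ∈ Ω
    · simp only [hζ hz]
    · have : ζ ∉ tsupport φ := fun hh => hz (h3 hh)
      simp [image_eq_zero_of_notMem_tsupport this]
  · filter_upwards [h] with ζ hζ
    by_cases hz : ζ ∈ Ω
    · simp only [hζ hz]
    · have : ζ ∉ tsupport (fun ζ => fderiv ℝ φ ζ v) :=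
        fun hh => hz (h3 ((fderiv_test h1 h2 v).2.2 hh))
      simp [image_eq_zero_of_notMem_tsupport this]

theorem unique [CompleteSpace V] (hf : HasWeakDeriv Ω f f')
    (hg : HasWeakDeriv Ω g g') (hfg : f =ᵐ[volume.restrict (Ω : Set (E d))] g) :
    f' =ᵐ[volume.restrict (Ω : Set (E d))] g' := by
  have hg := hg.congr hfg.symm (EventuallyEq.refl _ g')
  have key : ∀ v, ∀ᵐ ζ, ζ ∈ (Ω : Set (E d)) → f' ζ v - g' ζ v = 0 := by
    intro v
    refine Ω.isOpen.ae_eq_zero_of_integral_contDiff_smul_eq_zero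
      ((locInt_apply hf.locInt' v).sub (locInt_apply hg.locInt' v)) fun φ h1 h2 h3 => ?_
    simp only [smul_sub]
    rw [integral_sub (hf.int_right h1 h2 h3 v) (hg.int_right h1 h2 h3 v), sub_eq_zero]
    exact neg_injective ((hf.integral_eq φ h1 h2 h3 v).symm.trans (hg.integral_eq φ h1 h2 h3 v))
  rw [EventuallyEq, ae_restrict_iff' Ω.isOpen.measurableSet]
  have key2 := ae_all_iff.2 fun i : Fin d => key (EuclideanSpace.single i 1)
  filter_upwards [key2] with ζ hζ hz
  have : (f' ζ : E d →ₗ[ℝ] V) = g' ζ := by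
    refine (EuclideanSpace.basisFun (Fin d) ℝ).toBasis.ext fun i => ?_
    simpa [sub_eq_zero] using hζ i hz
  exact ContinuousLinearMap.coe_injective this

theorem of_contDiffOn [CompleteSpace V] (h : ContDiffOn ℝ 1 f Ω) :
    HasWeakDeriv Ω f (fderiv ℝ f) := by
  have l1 : LocallyIntegrableOn f Ω :=
    h.continuousOn.locallyIntegrableOn Ω.isOpen.measurableSet
  have l2 : LocallyIntegrableOn (fderiv ℝ f) Ω :=
    (h.continuousOn_fderiv_of_isOpen Ω.isOpen le_rfl).locallyIntegrableOn Ω.isOpen.measurableSet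
  refine ⟨l1, l2, fun φ h1 h2 h3 v => ?_⟩
  obtain ⟨q1, q2, q3⟩ := fderiv_test h1 h2 v
  have a1 := integrable_smul q1 q2 (q3.trans h3) l1
  have a2 := integrable_smul h1.continuous h2 h3 (locInt_apply l2 v)
  have a3 := integrable_smul h1.continuous h2 h3 l1
  rw [integral_smul_fderiv_eq_neg_fderiv_smul_of_integrable a1 a2 a3, neg_neg]
  · exact fun x _ => (h1.differentiable (by simp)) x
  · exact fun x hx => (h.contDiffAt (Ω.isOpen.mem_nhds (h3 hx))).differentiableAt (by simp)


/-- A smooth cutoff function. -/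
theorem _root_.SurfacePert.exists_cutoff {U : Type*} [NormedAddCommGroup U] [NormedSpace ℝ U]
    [FiniteDimensional ℝ U] {K O : Set U} (hK : IsCompact K) (hO : IsOpen O) (h : K ⊆ O) :
    ∃ χ : U → ℝ, ContDiff ℝ ∞ χ ∧ HasCompactSupport χ ∧ tsupport χ ⊆ O ∧
      ∀ᶠ x in 𝓝ˢ K, χ x = 1 := by
  obtain ⟨L, hL, hKL, hLO⟩ := exists_compact_between hK hO h
  obtain ⟨χ, h1, h2, -⟩ := exists_contMDiffMap_one_nhds_of_subset_interior (n := (⊤ : ℕ∞))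
    (modelWithCornersSelf ℝ U) hK.isClosed hKL
  have hs : tsupport χ ⊆ L := by
    refine closure_minimal (fun x hx => ?_) hL.isClosed
    by_contra hh
    exact hx (h2 x hh)
  exact ⟨χ, χ.contMDiff.contDiff, hL.of_isClosed_subset (isClosed_tsupport _) hs,
    hs.trans hLO, h1⟩

/-- Multiplication by a smooth cutoff function extends a weak derivative to the whole space. -/
theorem cutoff (hf : HasWeakDeriv Ω f f') {χ : E d → ℝ} (h1 : ContDiff ℝ ∞ χ)
    (h2 : HasCompactSupport χ) (h3 : tsupport χ ⊆ Ω) :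
    HasWeakDeriv ⊤ (fun ζ => χ ζ • f ζ) (fun ζ => χ ζ • f' ζ + (fderiv ℝ χ ζ).smulRight (f ζ)) := by
  have i1 := integrable_smul h1.continuous h2 h3 hf.locInt
  have i2 := integrable_smul h1.continuous h2 h3 hf.locInt'
  have i3 : Integrable (fun ζ => (fderiv ℝ χ ζ).smulRight (f ζ)) := by
    have hc : IsCompact (tsupport χ) := h2
    have j1 : IntegrableOn f (tsupport χ) := hf.locInt.integrableOn_compact_subset h3 hc
    obtain ⟨C, hC⟩ := hc.exists_bound_of_continuousOn
      (h1.continuous_fderiv (by simp)).continuousOn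
    have j2 : IntegrableOn (fun ζ => (fderiv ℝ χ ζ).smulRight (f ζ)) (tsupport χ) := by
      refine Integrable.mono' (j1.norm.const_mul C) ?_ ?_
      · exact ((ContinuousLinearMap.smulRightL ℝ (E d) V).continuous₂.comp_aestronglyMeasurable
          ((h1.continuous_fderiv (by simp)).aestronglyMeasurable.prodMk j1.1))
      · filter_upwards [ae_restrict_mem hc.measurableSet] with ζ hζ
        rw [ContinuousLinearMap.norm_smulRight_apply]
        exact mul_le_mul_of_nonneg_right (hC ζ hζ) (norm_nonneg _)
    refine integrable_of_support j2 ?_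
    intro ζ hζ
    by_contra h
    refine hζ ?_
    have : fderiv ℝ χ ζ = 0 := by
      by_contra hh
      exact h (support_fderiv_subset ℝ hh)
    simp [this]
  have i4 : Integrable (fun ζ => χ ζ • f' ζ + (fderiv ℝ χ ζ).smulRight (f ζ)) := i2.add i3
  refine ⟨i1.locallyIntegrable.locallyIntegrableOn _, i4.locallyIntegrable.locallyIntegrableOn _,
    fun φ g1 g2 _ v => ?_⟩
  have t1 : ContDiff ℝ ∞ (fun ζ => φ ζ * χ ζ) := g1.mul h1
  have t2 : HasCompactSupport (fun ζ => φ ζ * χ ζ) := h2.mul_left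
  have t3 : tsupport (fun ζ => φ ζ * χ ζ) ⊆ Ω := (tsupport_mul_subset_right).trans h3
  have e := hf.integral_eq _ t1 t2 t3 v
  have d1 : ∀ ζ, fderiv ℝ (fun ζ => φ ζ * χ ζ) ζ v • f ζ =
      fderiv ℝ φ ζ v • χ ζ • f ζ + φ ζ • fderiv ℝ χ ζ v • f ζ := by
    intro ζ
    rw [fderiv_fun_mul (g1.differentiable (by simp) ζ) (h1.differentiable (by simp) ζ)]
    simp only [add_apply, smul_apply, smul_eq_mul,
      smul_smul]
    rw [← add_smul]
    congr 1
    ring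
  obtain ⟨q1, q2, q3⟩ := fderiv_test g1 g2 v
  have k1 : Integrable fun ζ => fderiv ℝ φ ζ v • χ ζ • f ζ := by
    simpa using integrable_smul (Ω := ⊤) q1 q2 (by simp)
      (i1.locallyIntegrable.locallyIntegrableOn _)
  have k2 : Integrable fun ζ => φ ζ • fderiv ℝ χ ζ v • f ζ := by
    have := integrable_smul (Ω := ⊤) g1.continuous g2 (by simp)
      ((i3.apply_continuousLinearMap v).locallyIntegrable.locallyIntegrableOn _)
    simpa using this
  have k3 : Integrable fun ζ => (φ ζ * χ ζ) • f' ζ v := hf.int_right t1 t2 t3 v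
  simp only [d1] at e
  rw [integral_add k1 k2] at e
  rw [eq_sub_of_add_eq e, ← neg_add', ← integral_add k3 k2]
  congr 2
  ext ζ
  simp [smul_smul]

/-- Smooth approximation of a continuous function with bounded weak derivative. -/
theorem exists_mollify [FiniteDimensional ℝ V] (hf : HasWeakDeriv Ω f f')
    (hc : ContinuousOn f Ω) {R : ℝ}
    (hR : ∀ᵐ ζ ∂(volume.restrict (Ω : Set (E d))), ‖f' ζ‖ ≤ R)
    {K : Set (E d)} (hK : IsCompact K) (hKΩ : K ⊆ Ω) :
    ∃ (B : ℕ → E d → V) (M : ℝ), (∀ k, ContDiff ℝ ∞ (B k)) ∧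
      (∀ ζ ∈ K, Tendsto (fun k => B k ζ) atTop (𝓝 (f ζ))) ∧
      (∀ᵐ ζ, ζ ∈ K → Tendsto (fun k => fderiv ℝ (B k) ζ) atTop (𝓝 (f' ζ))) ∧
      ∀ k ζ, ‖fderiv ℝ (B k) ζ‖ ≤ M := by
  have : CompleteSpace V := FiniteDimensional.complete ℝ V
  obtain ⟨χ, h1, h2, h3, h4⟩ := exists_cutoff hK Ω.isOpen hKΩ
  set b : E d → V := fun ζ => χ ζ • f ζ with hb
  set b' : E d → E d →L[ℝ] V := fun ζ => χ ζ • f' ζ + (fderiv ℝ χ ζ).smulRight (f ζ) with hb'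
  have hw : HasWeakDeriv ⊤ b b' := hf.cutoff h1 h2 h3
  have hbc : Continuous b := by
    refine continuous_of_tsupport fun x hx => ?_
    have hx : x ∈ tsupport χ := tsupport_smul_subset_left χ f hx
    exact h1.continuous.continuousAt.smul (hc.continuousAt (Ω.isOpen.mem_nhds (h3 hx)))
  have hcpt : IsCompact (tsupport χ) := h2
  obtain ⟨M, hM0, hM⟩ : ∃ M : ℝ, 0 ≤ M ∧ ∀ᵐ ζ, ‖b' ζ‖ ≤ M := by
    obtain ⟨C1, hC1⟩ := hcpt.exists_bound_of_continuousOn h1.continuous.continuousOn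
    obtain ⟨C2, hC2⟩ := hcpt.exists_bound_of_continuousOn
      (h1.continuous_fderiv (by simp)).continuousOn
    obtain ⟨C3, hC3⟩ := hcpt.exists_bound_of_continuousOn (hc.mono h3)
    refine ⟨|C1| * |R| + |C2| * |C3|, by positivity, ?_⟩
    rw [ae_restrict_iff' Ω.isOpen.measurableSet] at hR
    filter_upwards [hR] with ζ hζ
    by_cases hz : ζ ∈ tsupport χ
    · refine (norm_add_le _ _).trans (add_le_add ?_ ?_)
      · rw [norm_smul]
        exact mul_le_mul ((hC1 ζ hz).trans (le_abs_self _)) ((hζ (h3 hz)).trans (le_abs_self _))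
          (norm_nonneg _) (abs_nonneg _)
      · rw [ContinuousLinearMap.norm_smulRight_apply]
        exact mul_le_mul ((hC2 ζ hz).trans (le_abs_self _)) ((hC3 ζ hz).trans (le_abs_self _))
          (norm_nonneg _) (abs_nonneg _)
    · have e1 : χ ζ = 0 := image_eq_zero_of_notMem_tsupport hz
      have e2 : fderiv ℝ χ ζ = 0 := by
        by_contra hh
        exact hz (support_fderiv_subset ℝ hh)
      simp only [hb', e1, e2]
      simp
      positivity
  have hbl : LocallyIntegrable b' := by
    have := hw.locInt'
    simpa [locallyIntegrableOn_univ] using this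
  let ψ : ℕ → ContDiffBump (0 : E d) := fun k =>
    ⟨1 / (k + 1 : ℝ), 2 * (1 / (k + 1 : ℝ)), by positivity, by
      have : (0 : ℝ) < 1 / (k + 1 : ℝ) := by positivity
      linarith⟩
  have hψ : Tendsto (fun k => (ψ k).rOut) atTop (𝓝 0) := by
    have := (tendsto_one_div_add_atTop_nhds_zero_nat (𝕜 := ℝ)).const_mul 2
    simpa [ψ] using this
  let L := ContinuousLinearMap.lsmul ℝ ℝ (E := V)
  let L' := ContinuousLinearMap.lsmul ℝ ℝ (E := E d →L[ℝ] V)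
  let B : ℕ → E d → V := fun k => convolution ((ψ k).normed volume) b L volume
  have hder : ∀ k ζ, fderiv ℝ (B k) ζ = convolution ((ψ k).normed volume) b' L' volume ζ := by
    intro k ζ
    have c1 : ContDiff ℝ ∞ ((ψ k).normed volume) := (ψ k).contDiff_normed
    have c2 : HasCompactSupport ((ψ k).normed volume) := (ψ k).hasCompactSupport_normed
    rw [(c2.hasFDerivAt_convolution_left L (c1.of_le (by simp))
      hbc.locallyIntegrable ζ).fderiv]
    ext v
    have w1 : ContDiff ℝ ∞ (fun s => (ψ k).normed volume (ζ - s)) :=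
      c1.comp (contDiff_const.sub contDiff_id)
    have w2 : HasCompactSupport (fun s => (ψ k).normed volume (ζ - s)) :=
      c2.comp_homeomorph (Homeomorph.subLeft ζ)
    have e := hw.integral_eq _ w1 w2 (by simp) v
    have hd : ∀ s, fderiv ℝ (fun s => (ψ k).normed volume (ζ - s)) s v =
        - fderiv ℝ ((ψ k).normed volume) (ζ - s) v := by
      intro s
      have h0 := ((c1.differentiable (by simp)) (ζ - s)).hasFDerivAt.comp s
        ((hasFDerivAt_const ζ s).sub (hasFDerivAt_id s))
      have h0' := h0.fderiv
      simp only [Function.comp_def] at h0'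
      rw [h0']
      simp
    simp only [hd, neg_smul, integral_neg, neg_inj] at e
    rw [convolution_eq_swap, convolution_eq_swap]
    have J1 : Integrable fun t => (L.precompL (E d)) (fderiv ℝ ((ψ k).normed volume) (ζ - t)) (b t) := by
      have := (c2.fderiv ℝ).convolutionExists_left (L.precompL (E d))
        (c1.continuous_fderiv (by simp)) (hbc.locallyIntegrable (μ := volume)) ζ
      exact this.integrable_swap
    have J2 : Integrable fun t => L' ((ψ k).normed volume (ζ - t)) (b' t) := by
      have := c2.convolutionExists_left L' c1.continuous hbl ζ
      exact this.integrable_swap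
    rw [ContinuousLinearMap.integral_apply J1, ContinuousLinearMap.integral_apply J2]
    simpa [L, L', ContinuousLinearMap.precompL_apply] using e
  refine ⟨B, M, fun k => ?_, fun ζ hζ => ?_, ?_, fun k ζ => ?_⟩
  · exact (ψ k).hasCompactSupport_normed.contDiff_convolution_left L (ψ k).contDiff_normed
      hbc.locallyIntegrable
  · have := ContDiffBump.convolution_tendsto_right_of_continuous (μ := volume) hψ hbc ζ
    have e : b ζ = f ζ := by simp [hb, h4.self_of_nhdsSet ζ hζ]
    rw [← e]
    exact this
  · have := ContDiffBump.ae_convolution_tendsto_right_of_locallyIntegrable (μ := volume)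
      (K := 2) hψ (Eventually.of_forall fun k => le_rfl) hbl
    filter_upwards [this] with ζ hζ hz
    have e0 : χ =ᶠ[𝓝 ζ] fun _ => 1 := (eventually_nhdsSet_iff_forall.1 h4) ζ hz
    have e : b' ζ = f' ζ := by
      simp only [hb', e0.fderiv_eq, e0.self_of_nhds]
      simp
    rw [← e]
    simp only [hder]
    exact hζ
  · rw [hder, convolution_eq_swap]
    have hi : Integrable fun t => (ψ k).normed volume (ζ - t) :=
      (ψ k).integrable_normed.comp_sub_left ζ
    calc ‖∫ t, L' ((ψ k).normed volume (ζ - t)) (b' t)‖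
        ≤ ∫ t, (ψ k).normed volume (ζ - t) * M := by
          refine norm_integral_le_of_norm_le (hi.mul_const M) ?_
          filter_upwards [hM] with t ht
          simp only [L', ContinuousLinearMap.lsmul_apply, norm_smul]
          rw [Real.norm_of_nonneg ((ψ k).nonneg_normed _)]
          exact mul_le_mul_of_nonneg_left ht ((ψ k).nonneg_normed _)
      _ = M := by
          rw [integral_mul_const, integral_sub_left_eq_self, (ψ k).integral_normed, one_mul]

end HasWeakDeriv
end
section
variable {d : ℕ} {V W : Type*} [NormedAddCommGroup V] [NormedSpace ℝ V]
  [NormedAddCommGroup W] [NormedSpace ℝ W] {Ω : Opens (E d)}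
  {f g : E d → V} {f' g' : E d → E d →L[ℝ] V}

theorem aesm_smulRight_comp {X U : Type*} [MeasurableSpace X] {μ : Measure X}
    [NormedAddCommGroup U] [NormedSpace ℝ U] {a : X → W →L[ℝ] ℝ} {b : X → U →L[ℝ] W} {c : X → V}
    (ha : AEStronglyMeasurable a μ) (hb : AEStronglyMeasurable b μ)
    (hc : AEStronglyMeasurable c μ) :
    AEStronglyMeasurable (fun x => (a x ∘L b x).smulRight (c x)) μ := by
  have h1 : Continuous fun p : (W →L[ℝ] ℝ) × (U →L[ℝ] W) => p.1 ∘L p.2 :=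
    (ContinuousLinearMap.compL ℝ U W ℝ).continuous₂
  have h2 : Continuous fun p : (U →L[ℝ] ℝ) × V => p.1.smulRight p.2 :=
    (ContinuousLinearMap.smulRightL ℝ U V).continuous₂
  exact h2.comp_aestronglyMeasurable ((h1.comp_aestronglyMeasurable (ha.prodMk hb)).prodMk hc)

namespace HasWeakDeriv

set_option maxHeartbeats 2000000 in
/-- Product of a weakly differentiable function with a smooth function of a continuous function
with bounded weak derivative. -/
theorem smul_comp [CompleteSpace V] [FiniteDimensional ℝ W] {A : E d → W} {A' : E d → E d →L[ℝ] W}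
    (hA : HasWeakDeriv Ω A A') (hc : ContinuousOn A Ω) {R : ℝ}
    (hR : ∀ᵐ ζ ∂(volume.restrict (Ω : Set (E d))), ‖A' ζ‖ ≤ R) {O : Set W} (hO : IsOpen O)
    (hAO : ∀ ζ ∈ Ω, A ζ ∈ O) {Φ : W → ℝ} (hΦ : ContDiffOn ℝ ∞ Φ O) (hf : HasWeakDeriv Ω f f') :
    HasWeakDeriv Ω (fun ζ => Φ (A ζ) • f ζ)
      (fun ζ => Φ (A ζ) • f' ζ + ((fderiv ℝ Φ (A ζ)) ∘L A' ζ).smulRight (f ζ)) := by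
  have hmaps : MapsTo A Ω O := hAO
  have c1 : ContinuousOn (fun ζ => Φ (A ζ)) Ω := hΦ.continuousOn.comp hc hmaps
  have c2 : ContinuousOn (fun ζ => fderiv ℝ Φ (A ζ)) Ω :=
    (hΦ.continuousOn_fderiv_of_isOpen hO (by simp)).comp hc hmaps
  have l0 : LocallyIntegrableOn (fun ζ => Φ (A ζ) • f ζ) Ω := by
    rw [locallyIntegrableOn_iff Ω.isOpen.isLocallyClosed]
    intro k hk hkc
    exact (hf.locInt.integrableOn_compact_subset hk hkc).continuousOn_smul (c1.mono hk) hkc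
  have l1 : LocallyIntegrableOn (fun ζ => Φ (A ζ) • f' ζ) Ω := by
    rw [locallyIntegrableOn_iff Ω.isOpen.isLocallyClosed]
    intro k hk hkc
    exact (hf.locInt'.integrableOn_compact_subset hk hkc).continuousOn_smul (c1.mono hk) hkc
  have l2 : LocallyIntegrableOn
      (fun ζ => ((fderiv ℝ Φ (A ζ)) ∘L A' ζ).smulRight (f ζ)) Ω := by
    rw [locallyIntegrableOn_iff Ω.isOpen.isLocallyClosed]
    intro k hk hkc
    have i1 := hf.locInt.integrableOn_compact_subset hk hkc
    have i2 := hA.locInt'.integrableOn_compact_subset hk hkc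
    obtain ⟨C, hC⟩ := hkc.exists_bound_of_continuousOn (c2.mono hk)
    refine Integrable.mono' (i1.norm.const_mul (|C| * |R|)) ?_ ?_
    · exact aesm_smulRight_comp ((c2.mono hk).aestronglyMeasurable hkc.measurableSet) i2.1 i1.1
    · filter_upwards [ae_restrict_mem hkc.measurableSet,
        ae_restrict_of_ae_restrict_of_subset hk hR] with ζ hζ hr
      rw [ContinuousLinearMap.norm_smulRight_apply]
      refine mul_le_mul_of_nonneg_right ?_ (norm_nonneg _)
      exact (ContinuousLinearMap.opNorm_comp_le _ _).trans
        (mul_le_mul ((hC ζ hζ).trans (le_abs_self _)) (hr.trans (le_abs_self _))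
          (norm_nonneg _) (abs_nonneg _))
  have l3 : LocallyIntegrableOn (fun ζ => Φ (A ζ) • f' ζ +
      ((fderiv ℝ Φ (A ζ)) ∘L A' ζ).smulRight (f ζ)) Ω :=
    locInt_add (U := E d →L[ℝ] V) l1 l2
  refine ⟨l0, l3, fun φ g1 g2 g3 v => ?_⟩
  have hK : IsCompact (tsupport φ) := g2
  obtain ⟨B, M, b1, b2, b3, b4⟩ := hA.exists_mollify hc hR hK g3
  obtain ⟨η, e1, e2, e3, e4⟩ := exists_cutoff (hK.image_of_continuousOn (hc.mono g3)) hO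
    (by rintro _ ⟨ζ, hζ, rfl⟩; exact hAO ζ (g3 hζ))
  let Ψ : W → ℝ := fun w => η w * Φ w
  have hΨ : ContDiff ℝ ∞ Ψ := by
    refine contDiff_iff_contDiffAt.2 fun w => ?_
    by_cases hw : w ∈ tsupport η
    swap
    · have : Ψ =ᶠ[𝓝 w] fun _ => 0 := by
        filter_upwards [(isClosed_tsupport η).isOpen_compl.mem_nhds hw] with x hx
        simp [Ψ, image_eq_zero_of_notMem_tsupport hx]
      exact contDiffAt_const.congr_of_eventuallyEq this
    exact e1.contDiffAt.mul (hΦ.contDiffAt (hO.mem_nhds (e3 hw)))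
  have hΨc : HasCompactSupport Ψ := e2.mul_right
  obtain ⟨C0, hC0⟩ := hΨc.exists_bound_of_continuous hΨ.continuous
  obtain ⟨C1, hC1⟩ := (hΨc.fderiv ℝ).exists_bound_of_continuous (hΨ.continuous_fderiv (by simp))
  have hC0' : 0 ≤ C0 := (norm_nonneg _).trans (hC0 0)
  have hC1' : 0 ≤ C1 := (norm_nonneg _).trans (hC1 0)
  have hM' : 0 ≤ M := (norm_nonneg _).trans (b4 0 0)
  have hΨΦ : ∀ ζ ∈ tsupport φ, Ψ =ᶠ[𝓝 (A ζ)] Φ := by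
    intro ζ hζ
    have := (eventually_nhdsSet_iff_forall.1 e4) (A ζ) ⟨ζ, hζ, rfl⟩
    filter_upwards [this] with w hw
    simp [Ψ, hw]
  have T1 : ∀ k, ContDiff ℝ ∞ (fun ζ => φ ζ * Ψ (B k ζ)) := fun k => g1.mul (hΨ.comp (b1 k))
  have T2 : ∀ k, HasCompactSupport (fun ζ => φ ζ * Ψ (B k ζ)) := fun k => g2.mul_right
  have T3 : ∀ k, tsupport (fun ζ => φ ζ * Ψ (B k ζ)) ⊆ Ω :=
    fun k => (tsupport_mul_subset_left).trans g3
  have T4 : ∀ k ζ, fderiv ℝ (fun ζ => φ ζ * Ψ (B k ζ)) ζ v =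
      fderiv ℝ φ ζ v * Ψ (B k ζ) + φ ζ * fderiv ℝ Ψ (B k ζ) (fderiv ℝ (B k) ζ v) := by
    intro k ζ
    have d1 : DifferentiableAt ℝ Ψ (B k ζ) := hΨ.differentiable (by simp) _
    have d2 : DifferentiableAt ℝ (B k) ζ := (b1 k).differentiable (by simp) _
    have d3 : fderiv ℝ (fun ζ => Ψ (B k ζ)) ζ = (fderiv ℝ Ψ (B k ζ)) ∘L (fderiv ℝ (B k) ζ) :=
      fderiv_fun_comp ζ d1 d2
    have d4 : DifferentiableAt ℝ (fun ζ => Ψ (B k ζ)) ζ := d1.comp ζ d2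
    rw [fderiv_fun_mul (g1.differentiable (by simp) ζ) d4, d3]
    simp
    ring
  obtain ⟨q1, q2, q3⟩ := fderiv_test g1 g2 v
  have z1 : ∀ ζ, ζ ∉ tsupport φ → φ ζ = 0 := fun ζ h => image_eq_zero_of_notMem_tsupport h
  have z2 : ∀ ζ, ζ ∉ tsupport φ → fderiv ℝ φ ζ v = 0 := fun ζ h =>
    image_eq_zero_of_notMem_tsupport (f := fun ζ => fderiv ℝ φ ζ v) fun hh => h (q3 hh)
  have I1 := integrable_smul q1 q2 (q3.trans g3) hf.locInt
  have I2 := integrable_smul g1.continuous g2 g3 hf.locInt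
  have I3 := integrable_smul g1.continuous g2 g3 (locInt_apply hf.locInt' v)
  have lim1 : Tendsto (fun k => ∫ ζ, fderiv ℝ (fun ζ => φ ζ * Ψ (B k ζ)) ζ v • f ζ) atTop
      (𝓝 (∫ ζ, (fderiv ℝ φ ζ v * Φ (A ζ) + φ ζ * fderiv ℝ Φ (A ζ) (A' ζ v)) • f ζ)) := by
    refine tendsto_integral_of_dominated_convergence
      (fun ζ => C0 * ‖fderiv ℝ φ ζ v • f ζ‖ + C1 * (M * ‖v‖) * ‖φ ζ • f ζ‖) (fun k => ?_)
      ((I1.norm.const_mul _).add (I2.norm.const_mul _)) (fun k => ?_) ?_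
    · exact (hf.int_left (T1 k) (T2 k) (T3 k) v).1
    · refine Eventually.of_forall fun ζ => ?_
      rw [T4, add_smul]
      refine (norm_add_le _ _).trans (add_le_add ?_ ?_)
      · rw [norm_smul, norm_mul, norm_smul]
        calc _ = ‖Ψ (B k ζ)‖ * (‖fderiv ℝ φ ζ v‖ * ‖f ζ‖) := by ring
          _ ≤ _ := mul_le_mul_of_nonneg_right (hC0 _) (by positivity)
      · rw [norm_smul, norm_mul, norm_smul]
        have : ‖fderiv ℝ Ψ (B k ζ) (fderiv ℝ (B k) ζ v)‖ ≤ C1 * (M * ‖v‖) :=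
          (ContinuousLinearMap.le_opNorm _ _).trans (mul_le_mul (hC1 _)
            ((ContinuousLinearMap.le_opNorm _ _).trans
              (mul_le_mul_of_nonneg_right (b4 k ζ) (norm_nonneg _))) (norm_nonneg _) hC1')
        calc _ = ‖fderiv ℝ Ψ (B k ζ) (fderiv ℝ (B k) ζ v)‖ * (‖φ ζ‖ * ‖f ζ‖) := by ring
          _ ≤ _ := mul_le_mul_of_nonneg_right this (by positivity)
    · filter_upwards [b3] with ζ hζ
      by_cases hz : ζ ∈ tsupport φ
      · simp only [T4]
        have t1 : Tendsto (fun k => Ψ (B k ζ)) atTop (𝓝 (Φ (A ζ))) := by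
          rw [← (hΨΦ ζ hz).self_of_nhds]
          exact (hΨ.continuous.tendsto _).comp (b2 ζ hz)
        have t2 : Tendsto (fun k => fderiv ℝ Ψ (B k ζ)) atTop (𝓝 (fderiv ℝ Φ (A ζ))) := by
          rw [← (hΨΦ ζ hz).fderiv_eq]
          exact ((hΨ.continuous_fderiv (by simp)).tendsto _).comp (b2 ζ hz)
        have t3 : Tendsto (fun k => fderiv ℝ (B k) ζ v) atTop (𝓝 (A' ζ v)) :=
          ((ContinuousLinearMap.apply ℝ W v).continuous.tendsto _).comp (hζ hz)
        have t4 : Tendsto (fun k => fderiv ℝ Ψ (B k ζ) (fderiv ℝ (B k) ζ v)) atTop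
            (𝓝 (fderiv ℝ Φ (A ζ) (A' ζ v))) :=
          (isBoundedBilinearMap_apply.continuous.tendsto (fderiv ℝ Φ (A ζ), A' ζ v)).comp
            (t2.prodMk_nhds t3)
        exact ((t1.const_mul _).add (t4.const_mul _)).smul_const _
      · simp only [T4, z1 ζ hz, z2 ζ hz]
        simp
  have lim2 : Tendsto (fun k => - ∫ ζ, (φ ζ * Ψ (B k ζ)) • f' ζ v) atTop
      (𝓝 (- ∫ ζ, (φ ζ * Φ (A ζ)) • f' ζ v)) := by
    refine (tendsto_integral_of_dominated_convergence
      (fun ζ => C0 * ‖φ ζ • f' ζ v‖) (fun k => ?_) (I3.norm.const_mul _) (fun k => ?_) ?_).neg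
    · exact (hf.int_right (T1 k) (T2 k) (T3 k) v).1
    · refine Eventually.of_forall fun ζ => ?_
      rw [norm_smul, norm_mul, norm_smul]
      calc _ = ‖Ψ (B k ζ)‖ * (‖φ ζ‖ * ‖f' ζ v‖) := by ring
        _ ≤ _ := mul_le_mul_of_nonneg_right (hC0 _) (by positivity)
    · refine Eventually.of_forall fun ζ => ?_
      by_cases hz : ζ ∈ tsupport φ
      · have t1 : Tendsto (fun k => Ψ (B k ζ)) atTop (𝓝 (Φ (A ζ))) := by
          rw [← (hΨΦ ζ hz).self_of_nhds]
          exact (hΨ.continuous.tendsto _).comp (b2 ζ hz)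
        exact (t1.const_mul _).smul_const _
      · simp [z1 ζ hz]
  have heq := tendsto_nhds_unique lim1 (lim2.congr fun k =>
    (hf.integral_eq _ (T1 k) (T2 k) (T3 k) v).symm)
  have J1 : Integrable fun ζ => fderiv ℝ φ ζ v • Φ (A ζ) • f ζ :=
    integrable_smul q1 q2 (q3.trans g3) l0
  have J2 : Integrable fun ζ => φ ζ • Φ (A ζ) • f' ζ v :=
    integrable_smul g1.continuous g2 g3 (locInt_apply l1 v)
  have J3 : Integrable fun ζ => φ ζ • (fderiv ℝ Φ (A ζ) (A' ζ v) • f ζ) :=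
    integrable_smul g1.continuous g2 g3 (locInt_apply l2 v)
  simp only [add_smul, mul_smul] at heq
  rw [integral_add J1 J3] at heq
  rw [eq_sub_of_add_eq heq, ← neg_add', ← integral_add J2 J3]
  congr 2
  ext ζ
  simp

end HasWeakDeriv
end

/-- The norm of `L^∞(μ)`. -/
def LInfNorm {U V : Type*} [MeasurableSpace U] [NormedAddCommGroup V] (μ : Measure U)
    (f : U → V) : ℝ≥0∞ :=
  eLpNorm f ⊤ μ

/-- The norm of `W^{2,∞}(Ω)`, with the value `∞` off this space. -/
def W2InfNorm {d : ℕ} {V : Type*} [NormedAddCommGroup V] [NormedSpace ℝ V]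
    (Ω : Opens (E d)) (f : E d → V) : ℝ≥0∞ :=
  ⨅ (f' : E d → E d →L[ℝ] V) (f'' : E d → E d →L[ℝ] E d →L[ℝ] V)
    (_ : HasWeakDeriv Ω f f') (_ : HasWeakDeriv Ω f' f''),
    LInfNorm (volume.restrict Ω) f + LInfNorm (volume.restrict Ω) f'
      + LInfNorm (volume.restrict Ω) f''

/-- A `d`-dimensional surface in `ℝ^{d+1}` given by one regular (`C¹`, injective, immersive)
patch `m : Ω → ℝ^{d+1}`. -/
structure Patch (d : ℕ) (Ω : Opens (E d)) where
  m : E d → E (d + 1)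
  contDiffOn : ContDiffOn ℝ 1 m Ω
  injOn : InjOn m Ω
  immersion : ∀ ζ ∈ Ω, Function.Injective (fderiv ℝ m ζ)

namespace Patch

variable {d : ℕ} {Ω : Opens (E d)} (S : Patch d Ω)

/-- The inverse `m⁻¹ : M → Ω` of the parametrization (arbitrary off the surface `M = m(Ω)`). -/
def inv : E (d + 1) → E d := Function.invFunOn S.m Ω

/-- The Jacobian `∂m`. -/
def jac (ζ : E d) : E d →L[ℝ] E (d + 1) := fderiv ℝ S.m ζ

/-- The metric tensor `g = ∂mᵀ ∂m`. -/
def metric (ζ : E d) : E d →L[ℝ] E d := (S.jac ζ).adjoint ∘L S.jac ζ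

/-- The Moore-Penrose inverse `∂m† = g⁻¹ ∂mᵀ`. -/
def pinv (ζ : E d) : E (d + 1) →L[ℝ] E d := (S.metric ζ).inverse ∘L (S.jac ζ).adjoint

/-- The surface measure `ds = √(det g) dζ` on `M`, as a measure on `ℝ^{d+1}`. -/
def area : Measure (E (d + 1)) :=
  ((volume.restrict (Ω : Set (E d))).withDensity
    fun ζ => ENNReal.ofReal (Real.sqrt (S.metric ζ).det)).map S.m

/-- The tangent space `T_x M`, for `x ∈ M`. -/
def tangent (x : E (d + 1)) : Submodule ℝ (E (d + 1)) := (S.jac (S.inv x)).range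

/-- The orthogonal projection onto the tangent space. -/
def projT (x : E (d + 1)) : E (d + 1) →L[ℝ] E (d + 1) := (S.tangent x).starProjection

/-- The orthogonal projection onto the normal space `N_x M = (T_x M)ᗮ`. -/
def projN (x : E (d + 1)) : E (d + 1) →L[ℝ] E (d + 1) := (S.tangent x)ᗮ.starProjection

/-- `G` is the (weak) surface gradient of `v : M → V`, that is `G ∘ m = ∂(v ∘ m) ∂m†`. -/
def HasSurfaceGrad {V : Type*} [NormedAddCommGroup V] [NormedSpace ℝ V]
    (v : E (d + 1) → V) (G : E (d + 1) → E (d + 1) →L[ℝ] V) : Prop :=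
  ∃ D : E d → E d →L[ℝ] V, HasWeakDeriv Ω (v ∘ S.m) D ∧
    ∀ᵐ ζ ∂(volume.restrict (Ω : Set (E d))), G (S.m ζ) = D ζ ∘L S.pinv ζ

/-- `v ∈ W^{2,∞}(M, V)`. -/
def MemW2Inf {V : Type*} [NormedAddCommGroup V] [NormedSpace ℝ V] (v : E (d + 1) → V) : Prop :=
  ∃ (G : E (d + 1) → E (d + 1) →L[ℝ] V) (H : E (d + 1) → E (d + 1) →L[ℝ] E (d + 1) →L[ℝ] V),
    S.HasSurfaceGrad v G ∧ S.HasSurfaceGrad G H ∧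
    LInfNorm S.area v < ⊤ ∧ LInfNorm S.area G < ⊤ ∧ LInfNorm S.area H < ⊤

end Patch

/-- A surface whose parametrization is in `W^{2,∞}(Ω)`, with inverse in `W^{2,∞}(M)`. -/
structure W2Patch (d : ℕ) (Ω : Opens (E d)) extends Patch d Ω where
  norm_lt_top : W2InfNorm Ω m < ⊤
  inv_mem : toPatch.MemW2Inf toPatch.inv

section Gram

variable {d n : ℕ}

/-- The orthogonal projection onto the range of an injective linear map. -/
def gramProj (A : E d →L[ℝ] E n) : E n →L[ℝ] E n :=
  A ∘L (Ring.inverse (A.adjoint ∘L A) ∘L A.adjoint)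

theorem isUnit_gram {A : E d →L[ℝ] E n} (h : Function.Injective A) :
    IsUnit (A.adjoint ∘L A : E d →L[ℝ] E d) := by
  have hi : Function.Injective (A.adjoint ∘L A) := by
    refine (injective_iff_map_eq_zero _).2 fun x hx => ?_
    have : inner ℝ (A x) (A x) = 0 := by
      rw [← ContinuousLinearMap.adjoint_inner_left]
      have : A.adjoint (A x) = 0 := hx
      rw [this, inner_zero_left]
    exact (injective_iff_map_eq_zero A).1 h x (inner_self_eq_zero.1 this)
  let e := (LinearEquiv.ofInjectiveEndo (A.adjoint ∘L A : E d →L[ℝ] E d).toLinearMap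
    hi).toContinuousLinearEquiv
  have : (A.adjoint ∘L A : E d →L[ℝ] E d) = e := by
    ext x
    rfl
  rw [this]
  exact ⟨ContinuousLinearEquiv.toUnit e, rfl⟩

theorem gram_inv {A : E d →L[ℝ] E n} (h : IsUnit (A.adjoint ∘L A : E d →L[ℝ] E d)) :
    (Ring.inverse (A.adjoint ∘L A) ∘L A.adjoint) ∘L A = ContinuousLinearMap.id ℝ (E d) := by
  have := Ring.inverse_mul_cancel _ h
  rw [ContinuousLinearMap.comp_assoc]
  exact this

theorem adjoint_bdd : IsBoundedLinearMap ℝ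
    (fun A : E d →L[ℝ] E n => (A.adjoint : E n →L[ℝ] E d)) := by
  refine IsLinearMap.with_bound ⟨fun A B => map_add _ A B, fun c A => ?_⟩ 1 fun A => ?_
  · simp
  · simp

theorem contDiff_gram : ContDiff ℝ ∞ (fun A : E d →L[ℝ] E n => (A.adjoint ∘L A : E d →L[ℝ] E d)) :=
  adjoint_bdd.contDiff.clm_comp contDiff_id

theorem isOpen_gram : IsOpen {A : E d →L[ℝ] E n | IsUnit (A.adjoint ∘L A : E d →L[ℝ] E d)} :=
  Units.isOpen.preimage contDiff_gram.continuous

theorem contDiffOn_gramProj : ContDiffOn ℝ ∞ (gramProj (d := d) (n := n))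
    {A | IsUnit (A.adjoint ∘L A : E d →L[ℝ] E d)} := by
  intro A hA
  obtain ⟨u, hu⟩ := hA
  have h1 : ContDiffAt ℝ ∞ (fun A : E d →L[ℝ] E n =>
      (Ring.inverse (A.adjoint ∘L A : E d →L[ℝ] E d))) A := by
    have := contDiffAt_ringInverse (n := ∞) ℝ u
    rw [hu] at this
    exact ContDiffAt.comp (g := Ring.inverse)
      (f := fun A : E d →L[ℝ] E n => (A.adjoint ∘L A : E d →L[ℝ] E d)) A this
      contDiff_gram.contDiffAt
  exact (contDiffAt_id.clm_comp (h1.clm_comp adjoint_bdd.contDiff.contDiffAt)).contDiffWithinAt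

/-- The entries of the projection matrix. -/
def gramEntry (i j : Fin n) (A : E d →L[ℝ] E n) : ℝ :=
  inner ℝ (EuclideanSpace.single i 1) (gramProj A (EuclideanSpace.single j 1))

theorem contDiffOn_gramEntry (i j : Fin n) : ContDiffOn ℝ ∞ (gramEntry (d := d) i j)
    {A | IsUnit (A.adjoint ∘L A : E d →L[ℝ] E d)} :=
  contDiffOn_const.inner ℝ (contDiffOn_gramProj.clm_apply contDiffOn_const)

theorem exists_bound_gramEntry (R : ℝ) : ∃ C : ℝ, 0 ≤ C ∧ ∀ (i j : Fin n) (A : E d →L[ℝ] E n),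
    ‖A‖ ≤ R → (∀ x, ‖x‖ ≤ R * ‖A x‖) → ‖fderiv ℝ (gramEntry i j) A‖ ≤ C := by
  let s : Set (E d →L[ℝ] E n) := {A | ‖A‖ ≤ R ∧ ∀ x, ‖x‖ ≤ R * ‖A x‖}
  have hs : IsCompact s := by
    refine Metric.isCompact_of_isClosed_isBounded ?_ ?_
    · have : s = {A | ‖A‖ ≤ R} ∩ ⋂ x, {A | ‖x‖ ≤ R * ‖A x‖} := by
        ext A
        simp [s]
      rw [this]
      refine (isClosed_le continuous_norm continuous_const).inter (isClosed_iInter fun x => ?_)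
      exact isClosed_le continuous_const
        (continuous_const.mul ((ContinuousLinearMap.apply ℝ (E n) x).continuous.norm))
    · exact (Metric.isBounded_closedBall (x := (0 : E d →L[ℝ] E n)) (r := R)).subset
        fun A hA => by simpa using hA.1
  have hsO : s ⊆ {A | IsUnit (A.adjoint ∘L A : E d →L[ℝ] E d)} := by
    intro A hA
    refine isUnit_gram ((injective_iff_map_eq_zero A).2 fun x hx => ?_)
    have := hA.2 x
    rw [hx, norm_zero, mul_zero] at this
    exact norm_le_zero_iff.1 this
  have key : ∀ p : Fin n × Fin n, ∃ C : ℝ, ∀ A ∈ s, ‖fderiv ℝ (gramEntry p.1 p.2) A‖ ≤ C := by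
    intro p
    exact hs.exists_bound_of_continuousOn
      (((contDiffOn_gramEntry p.1 p.2).continuousOn_fderiv_of_isOpen isOpen_gram (by simp)).mono
        hsO)
  choose C hC using key
  refine ⟨∑ p, |C p|, Finset.sum_nonneg fun _ _ => abs_nonneg _, fun i j A h1 h2 => ?_⟩
  refine (hC (i, j) A ⟨h1, h2⟩).trans ((le_abs_self _).trans ?_)
  exact Finset.single_le_sum (f := fun p => |C p|) (fun _ _ => abs_nonneg _)
    (Finset.mem_univ (i, j))

theorem sum_gramEntry (A : E d →L[ℝ] E n) (x : E n) :
    ∑ p : Fin n × Fin n, gramEntry p.1 p.2 A • x p.2 • (EuclideanSpace.single p.1 1 : E n) =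
      gramProj A x := by
  ext k
  have hx : x = ∑ j, x j • (EuclideanSpace.single j 1 : E n) := by
    ext i
    simp [Pi.single_apply]
  conv_rhs => rw [hx]
  simp only [Fintype.sum_prod_type, gramEntry, EuclideanSpace.inner_single_left]
  rw [Finset.sum_comm]
  simp only [map_one, one_mul, map_sum, map_smul, WithLp.ofLp_sum, Finset.sum_apply,
    WithLp.ofLp_smul, Pi.smul_apply, smul_eq_mul, PiLp.ofLp_single, Pi.single_apply]
  refine Finset.sum_congr rfl fun j _ => ?_
  simp [mul_comm]

end Gram

namespace Patch

variable {d : ℕ} {Ω : Opens (E d)} (S : Patch d Ω)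

theorem inv_m {ζ : E d} (hζ : ζ ∈ Ω) : S.inv (S.m ζ) = ζ :=
  S.injOn.leftInvOn_invFunOn hζ

theorem isUnit_metric {ζ : E d} (hζ : ζ ∈ Ω) : IsUnit (S.metric ζ) :=
  isUnit_gram (S.immersion ζ hζ)

theorem pinv_eq (ζ : E d) :
    S.pinv ζ = Ring.inverse ((S.jac ζ).adjoint ∘L S.jac ζ) ∘L (S.jac ζ).adjoint := by
  rw [ContinuousLinearMap.ringInverse_eq_inverse]
  rfl

theorem pinv_comp_jac {ζ : E d} (hζ : ζ ∈ Ω) :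
    S.pinv ζ ∘L S.jac ζ = ContinuousLinearMap.id ℝ (E d) := by
  rw [pinv_eq]
  exact gram_inv (S.isUnit_metric hζ)

theorem projT_m {ζ : E d} (hζ : ζ ∈ Ω) : S.projT (S.m ζ) = gramProj (S.jac ζ) := by
  ext1 x
  rw [projT]
  refine Submodule.eq_starProjection_of_mem_orthogonal (K := S.tangent (S.m ζ)) ?_ ?_
  · rw [tangent, S.inv_m hζ]
    exact ⟨_, rfl⟩
  · rw [tangent, S.inv_m hζ, Submodule.mem_orthogonal]
    rintro _ ⟨y, rfl⟩
    have h := Ring.mul_inverse_cancel _ (S.isUnit_metric hζ)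
    have h' : (S.jac ζ).adjoint (gramProj (S.jac ζ) x) = (S.jac ζ).adjoint x :=
      congrArg (fun L : E d →L[ℝ] E d => L ((S.jac ζ).adjoint x)) h
    change inner ℝ (S.jac ζ y) _ = 0
    rw [← ContinuousLinearMap.adjoint_inner_right, map_sub, h', sub_self, inner_zero_right]

theorem projN_eq (x : E (d + 1)) : S.projN x = ContinuousLinearMap.id ℝ _ - S.projT x :=
  (S.tangent x).starProjection_orthogonal

theorem projT_norm (x : E (d + 1)) : ‖S.projT x‖ ≤ 1 :=
  (S.tangent x).starProjection_norm_le

theorem projN_norm (x : E (d + 1)) : ‖S.projN x‖ ≤ 1 :=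
  (S.tangent x)ᗮ.starProjection_norm_le

theorem projT_projT (x : E (d + 1)) : S.projT x ∘L S.projT x = S.projT x :=
  Submodule.isIdempotentElem_starProjection _

theorem projN_projN (x : E (d + 1)) : S.projN x ∘L S.projN x = S.projN x :=
  Submodule.isIdempotentElem_starProjection _

theorem det_metric_pos {ζ : E d} (hζ : ζ ∈ Ω) : 0 < (S.metric ζ).det := by
  have h0 : (S.metric ζ).det ≠ 0 := by
    have := (LinearMap.isUnit_iff_isUnit_det (S.metric ζ).toLinearMap).1
      ((S.isUnit_metric hζ).map (ContinuousLinearMap.toLinearMapRingHom : (E d →L[ℝ] E d) →+* _))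
    exact this.ne_zero
  refine lt_of_le_of_ne ?_ h0.symm
  let b := EuclideanSpace.basisFun (Fin d) ℝ
  let c := EuclideanSpace.basisFun (Fin (d + 1)) ℝ
  have h : (S.metric ζ).det = (LinearMap.toMatrix b.toBasis b.toBasis
      (S.metric ζ).toLinearMap).det := (LinearMap.det_toMatrix _ _).symm
  have h2 : LinearMap.toMatrix b.toBasis b.toBasis (S.metric ζ).toLinearMap =
      (LinearMap.toMatrix b.toBasis c.toBasis (S.jac ζ).toLinearMap).conjTranspose *
        LinearMap.toMatrix b.toBasis c.toBasis (S.jac ζ).toLinearMap := by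
    rw [← LinearMap.toMatrix_adjoint, ← LinearMap.toMatrix_comp]
    rfl
  rw [h, h2]
  exact (Matrix.posSemidef_conjTranspose_mul_self _).det_nonneg

end Patch

namespace Patch

variable {d : ℕ} {Ω : Opens (E d)} (S : Patch d Ω)

/-- The surface measure in the parameter domain. -/
def param : Measure (E d) :=
  (volume.restrict (Ω : Set (E d))).withDensity
    fun ζ => ENNReal.ofReal (Real.sqrt (S.metric ζ).det)

theorem area_eq : S.area = S.param.map S.m := rfl

theorem continuousOn_jac : ContinuousOn S.jac Ω :=
  S.contDiffOn.continuousOn_fderiv_of_isOpen Ω.isOpen le_rfl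

theorem continuousOn_metric : ContinuousOn S.metric Ω :=
  contDiff_gram.continuous.comp_continuousOn S.continuousOn_jac

theorem measurableSet_dom : MeasurableSet (Ω : Set (E d)) := Ω.isOpen.measurableSet

theorem aemeasurable_dens : AEMeasurable
    (fun ζ => ENNReal.ofReal (Real.sqrt (S.metric ζ).det)) (volume.restrict (Ω : Set (E d))) := by
  have h : ContinuousOn (fun ζ => Real.sqrt (S.metric ζ).det) Ω :=
    Real.continuous_sqrt.comp_continuousOn
      (ContinuousLinearMap.continuous_det.comp_continuousOn S.continuousOn_metric)
  exact (h.aemeasurable measurableSet_dom).ennreal_ofReal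

theorem ae_param {p : E d → Prop} :
    (∀ᵐ ζ ∂S.param, p ζ) ↔ ∀ᵐ ζ ∂(volume.restrict (Ω : Set (E d))), p ζ := by
  constructor
  · intro h
    refine (withDensity_absolutelyContinuous' S.aemeasurable_dens ?_).ae_le h
    filter_upwards [ae_restrict_mem measurableSet_dom] with ζ hζ
    have := Real.sqrt_pos.2 (S.det_metric_pos hζ)
    simpa using this
  · exact fun h => (withDensity_absolutelyContinuous _ _).ae_le h

theorem aemeasurable_m : AEMeasurable S.m S.param :=
  (S.contDiffOn.continuousOn.aemeasurable measurableSet_dom).mono_ac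
    (withDensity_absolutelyContinuous _ _)

theorem measurable_inv : Measurable S.inv := by
  classical
  intro B hB
  have hc : ContinuousOn S.m Ω := S.contDiffOn.continuousOn
  have h1 : MeasurableSet (S.m '' (Ω ∩ B)) :=
    (measurableSet_dom.inter hB).image_of_continuousOn_injOn (hc.mono inter_subset_left)
      (S.injOn.mono inter_subset_left)
  have h2 : MeasurableSet (S.m '' Ω) :=
    measurableSet_dom.image_of_continuousOn_injOn hc S.injOn
  have h3 : S.inv ⁻¹' B ∩ S.m '' Ω = S.m '' (Ω ∩ B) := by
    ext x
    constructor
    · rintro ⟨hx, ζ, hζ, rfl⟩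
      rw [mem_preimage, S.inv_m hζ] at hx
      exact ⟨ζ, ⟨hζ, hx⟩, rfl⟩
    · rintro ⟨ζ, ⟨hζ, hb⟩, rfl⟩
      refine ⟨?_, ζ, hζ, rfl⟩
      rwa [mem_preimage, S.inv_m hζ]
  have h4 : ∃ c : E d, ∀ x ∉ S.m '' Ω, S.inv x = c :=
    ⟨Classical.choice ⟨0⟩, fun x hx => Function.invFunOn_neg fun ⟨a, ha, hb⟩ => hx ⟨a, ha, hb⟩⟩
  obtain ⟨c, hc'⟩ := h4
  have h5 : S.inv ⁻¹' B = S.m '' (Ω ∩ B) ∪ (if c ∈ B then (S.m '' Ω)ᶜ else ∅) := by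
    rw [← h3]
    ext x
    by_cases hx : x ∈ S.m '' Ω
    · by_cases hcB : c ∈ B <;> simp [hx, hcB]
    · by_cases hcB : c ∈ B <;> simp [hx, hcB, hc' x hx]
  rw [h5]
  refine h1.union ?_
  split_ifs
  · exact h2.compl
  · exact MeasurableSet.empty

theorem measurePreserving_inv : MeasurePreserving S.inv S.area S.param := by
  refine ⟨S.measurable_inv, ?_⟩
  rw [area_eq, AEMeasurable.map_map_of_aemeasurable S.measurable_inv.aemeasurable S.aemeasurable_m]
  have : S.inv ∘ S.m =ᵐ[S.param] id := by
    refine S.ae_param.2 ?_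
    filter_upwards [ae_restrict_mem measurableSet_dom] with ζ hζ
    exact S.inv_m hζ
  rw [Measure.map_congr this, Measure.map_id]

theorem ae_area {p : E (d + 1) → Prop} :
    (∀ᵐ x ∂S.area, p x) ↔ ∀ᵐ ζ ∂(volume.restrict (Ω : Set (E d))), p (S.m ζ) := by
  constructor
  · intro h
    exact S.ae_param.1 (ae_of_ae_map S.aemeasurable_m h)
  · intro h
    have h1 : ∀ᵐ x ∂S.area, p (S.m (S.inv x)) :=
      S.measurePreserving_inv.quasiMeasurePreserving.ae (S.ae_param.2 h)
    have h2 : ∀ᵐ x ∂S.area, x ∈ S.m '' Ω := by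
      rw [area_eq]
      refine (ae_map_iff (p := fun x => x ∈ S.m '' Ω) S.aemeasurable_m
        (measurableSet_dom.image_of_continuousOn_injOn S.contDiffOn.continuousOn S.injOn)).2 ?_
      refine S.ae_param.2 ?_
      filter_upwards [ae_restrict_mem measurableSet_dom] with ζ hζ
      exact ⟨ζ, hζ, rfl⟩
    filter_upwards [h1, h2] with x hx hx2
    obtain ⟨ζ, hζ, rfl⟩ := hx2
    rwa [S.inv_m hζ] at hx

theorem memLp_param {V : Type*} [NormedAddCommGroup V] {h : E (d + 1) → V}
    (hh : MemLp h 2 S.area) : MemLp (fun ζ => h (S.m ζ)) 2 S.param := by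
  rw [area_eq] at hh
  exact (memLp_map_measure_iff hh.1 S.aemeasurable_m).1 hh

theorem memLp_area {V : Type*} [NormedAddCommGroup V] {h : E (d + 1) → V}
    (hh : MemLp (fun ζ => h (S.m ζ)) 2 S.param) : MemLp h 2 S.area := by
  refine (hh.comp_measurePreserving S.measurePreserving_inv).ae_eq ?_
  refine S.ae_area.2 ?_
  filter_upwards [ae_restrict_mem measurableSet_dom] with ζ hζ
  simp [S.inv_m hζ]

end Patch

namespace W2Patch

variable {d : ℕ} {Ω : Opens (E d)} (S : W2Patch d Ω)

theorem ae_bound {U V : Type*} [MeasurableSpace U] [NormedAddCommGroup V] {μ : Measure U}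
    {f : U → V} (h : LInfNorm μ f < ⊤) : ∃ R : ℝ, 0 ≤ R ∧ ∀ᵐ x ∂μ, ‖f x‖ ≤ R := by
  rw [LInfNorm, eLpNorm_exponent_top] at h
  refine ⟨(eLpNormEssSup f μ).toReal, ENNReal.toReal_nonneg, ?_⟩
  filter_upwards [ae_le_eLpNormEssSup (f := f) (μ := μ)] with x hx
  have := ENNReal.toReal_mono h.ne hx
  simpa using this

theorem exists_jac : ∃ (R : ℝ) (J : E d → E d →L[ℝ] E d →L[ℝ] E (d + 1)), 0 ≤ R ∧
    HasWeakDeriv Ω S.jac J ∧ (∀ᵐ ζ ∂(volume.restrict (Ω : Set (E d))), ‖S.jac ζ‖ ≤ R) ∧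
      ∀ᵐ ζ ∂(volume.restrict (Ω : Set (E d))), ‖J ζ‖ ≤ R := by
  have h0 := S.norm_lt_top
  simp only [W2InfNorm, iInf_lt_iff] at h0
  obtain ⟨f', f'', hf, hf', hlt⟩ := h0
  have e1 : f' =ᵐ[volume.restrict (Ω : Set (E d))] S.jac :=
    hf.unique (HasWeakDeriv.of_contDiffOn S.contDiffOn) (EventuallyEq.refl _ _)
  obtain ⟨R1, p1, b1⟩ := ae_bound (lt_of_le_of_lt (le_add_self.trans le_self_add) hlt)
  obtain ⟨R2, p2, b2⟩ := ae_bound (lt_of_le_of_lt le_add_self hlt)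
  refine ⟨R1 + R2, f'', by positivity, hf'.congr e1 (EventuallyEq.refl _ _), ?_, ?_⟩
  · filter_upwards [b1, e1] with ζ a1 a2
    rw [← a2]
    linarith
  · filter_upwards [b2] with ζ a1
    linarith

theorem exists_pinv : ∃ R : ℝ, 0 ≤ R ∧
    ∀ᵐ ζ ∂(volume.restrict (Ω : Set (E d))), ‖S.pinv ζ‖ ≤ R := by
  obtain ⟨G, H, ⟨D, hD, hG⟩, -, -, hGb, -⟩ := S.inv_mem
  have hid : HasWeakDeriv Ω (fun ζ : E d => ζ) (fderiv ℝ fun ζ : E d => ζ) :=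
    HasWeakDeriv.of_contDiffOn contDiffOn_id
  have e2 : D =ᵐ[volume.restrict (Ω : Set (E d))] (fderiv ℝ fun ζ : E d => ζ) := by
    refine hD.unique hid ?_
    filter_upwards [ae_restrict_mem Patch.measurableSet_dom] with ζ hζ
    exact S.inv_m hζ
  obtain ⟨R, p, b⟩ := ae_bound hGb
  refine ⟨R, p, ?_⟩
  filter_upwards [S.ae_area.1 b, hG, e2] with ζ a1 a2 a3
  rw [a2, a3] at a1
  simpa only [fderiv_fun_id, ContinuousLinearMap.id_comp] using a1

theorem exists_bounds : ∃ (R : ℝ) (J : E d → E d →L[ℝ] E d →L[ℝ] E (d + 1)), 0 ≤ R ∧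
    HasWeakDeriv Ω S.jac J ∧ ∀ᵐ ζ ∂(volume.restrict (Ω : Set (E d))),
      ‖S.jac ζ‖ ≤ R ∧ ‖S.pinv ζ‖ ≤ R ∧ ‖J ζ‖ ≤ R := by
  obtain ⟨R1, J, p1, hJ, a1, a2⟩ := S.exists_jac
  obtain ⟨R2, p2, a3⟩ := S.exists_pinv
  refine ⟨R1 + R2, J, by positivity, hJ, ?_⟩
  filter_upwards [a1, a2, a3] with ζ h1 h2 h3
  exact ⟨by linarith, by linarith, by linarith⟩

/-- The projections preserve weak differentiability. -/
theorem exists_proj : ∃ C : ℝ, 0 ≤ C ∧ ∀ (u : E d → E (d + 1)) (D : E d → E d →L[ℝ] E (d + 1)),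
    HasWeakDeriv Ω u D → ∃ G : E d → E d →L[ℝ] E (d + 1),
      HasWeakDeriv Ω (fun ζ => S.projT (S.m ζ) (u ζ)) G ∧
      HasWeakDeriv Ω (fun ζ => S.projN (S.m ζ) (u ζ)) (fun ζ => D ζ - G ζ) ∧
      ∀ᵐ ζ ∂(volume.restrict (Ω : Set (E d))),
        ‖G ζ - S.projT (S.m ζ) ∘L D ζ‖ ≤ C * ‖u ζ‖ := by
  obtain ⟨R, J, hR, hJ, hb⟩ := S.exists_bounds
  obtain ⟨C, hC, hCb⟩ := exists_bound_gramEntry (d := d) (n := d + 1) R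
  refine ⟨∑ p : Fin (d + 1) × Fin (d + 1), C * R, by positivity, fun u D hu => ?_⟩
  let L : Fin (d + 1) × Fin (d + 1) → E (d + 1) →L[ℝ] E (d + 1) := fun p =>
    (EuclideanSpace.proj (𝕜 := ℝ) p.2 : E (d + 1) →L[ℝ] ℝ).smulRight (EuclideanSpace.single p.1 1)
  have hLx : ∀ p x, L p x = x p.2 • (EuclideanSpace.single p.1 1 : E (d + 1)) := fun p x => rfl
  have hL1 : ∀ p x, ‖L p x‖ ≤ ‖x‖ := by
    intro p x
    rw [hLx, norm_smul]
    simpa using PiLp.norm_apply_le x p.2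
  have hw : ∀ p, HasWeakDeriv Ω (fun ζ => gramEntry p.1 p.2 (S.jac ζ) • L p (u ζ))
      (fun ζ => gramEntry p.1 p.2 (S.jac ζ) • (L p ∘L D ζ) +
        ((fderiv ℝ (gramEntry p.1 p.2) (S.jac ζ)) ∘L J ζ).smulRight (L p (u ζ))) := fun p =>
    HasWeakDeriv.smul_comp hJ S.continuousOn_jac (hb.mono fun ζ h => h.2.2) isOpen_gram
      (fun ζ hζ => S.isUnit_metric hζ) (contDiffOn_gramEntry p.1 p.2) (hu.clm_comp (L p))
  have hsum := HasWeakDeriv.sum Finset.univ fun p _ => hw p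
  have hT := hsum.congr (g := fun ζ => S.projT (S.m ζ) (u ζ)) (by
    filter_upwards [ae_restrict_mem Patch.measurableSet_dom] with ζ hζ
    rw [S.projT_m hζ]
    exact sum_gramEntry _ _) (EventuallyEq.refl _ _)
  refine ⟨_, hT, ?_, ?_⟩
  · have hneg := hu.add (hT.const_smul (-1))
    refine hneg.congr (Eventually.of_forall fun ζ => ?_) (Eventually.of_forall fun ζ => ?_)
    · simp [S.projN_eq, sub_eq_add_neg]
    · simp only [neg_smul, one_smul, ← sub_eq_add_neg]
  · filter_upwards [ae_restrict_mem Patch.measurableSet_dom, hb] with ζ hζ hbζ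
    have e : S.projT (S.m ζ) ∘L D ζ =
        ∑ p : Fin (d + 1) × Fin (d + 1), gramEntry p.1 p.2 (S.jac ζ) • (L p ∘L D ζ) := by
      ext1 v
      rw [S.projT_m hζ]
      change gramProj (S.jac ζ) (D ζ v) = _
      rw [← sum_gramEntry]
      simp [hLx]
    rw [e, Finset.sum_add_distrib, add_sub_cancel_left, Finset.sum_mul]
    refine norm_sum_le_of_le _ fun p _ => ?_
    rw [ContinuousLinearMap.norm_smulRight_apply]
    refine mul_le_mul ?_ (hL1 p _) (norm_nonneg _) (by positivity)
    refine (ContinuousLinearMap.opNorm_comp_le _ _).trans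
      (mul_le_mul (hCb _ _ _ hbζ.1 fun x => ?_) hbζ.2.2 (norm_nonneg _) hC)
    have : S.pinv ζ (S.jac ζ x) = x :=
      congrArg (fun T : E d →L[ℝ] E d => T x) (S.pinv_comp_jac hζ)
    calc ‖x‖ = ‖S.pinv ζ (S.jac ζ x)‖ := by rw [this]
      _ ≤ ‖S.pinv ζ‖ * ‖S.jac ζ x‖ := ContinuousLinearMap.le_opNorm _ _
      _ ≤ R * ‖S.jac ζ x‖ := mul_le_mul_of_nonneg_right hbζ.2.1 (norm_nonneg _)

/-- The surface measures of two parametrizations over the same domain are comparable. -/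
theorem exists_param_le (S' : W2Patch d Ω) : ∃ K : ℝ≥0, S'.param ≤ K • S.param := by
  obtain ⟨R, _, hR, _, hb⟩ := S.exists_bounds
  obtain ⟨R', _, hR', _, hb'⟩ := S'.exists_bounds
  obtain ⟨C, hC⟩ := (isCompact_closedBall (0 : E d →L[ℝ] E d) (R * R)).exists_bound_of_continuousOn
    ContinuousLinearMap.continuous_det.continuousOn
  obtain ⟨C', hC'⟩ :=
    (isCompact_closedBall (0 : E d →L[ℝ] E d) (R' * R')).exists_bound_of_continuousOn
      ContinuousLinearMap.continuous_det.continuousOn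
  refine ⟨Real.toNNReal (Real.sqrt (C' * C)), ?_⟩
  have hK : (Real.toNNReal (Real.sqrt (C' * C))) • S.param =
      ((Real.toNNReal (Real.sqrt (C' * C)) : ℝ≥0) : ℝ≥0∞) • S.param := rfl
  rw [hK, Patch.param, Patch.param, ← withDensity_smul' _ _ ENNReal.coe_ne_top]
  refine withDensity_mono ?_
  filter_upwards [ae_restrict_mem Patch.measurableSet_dom, hb, hb'] with ζ hζ h h'
  have q1 : (S'.metric ζ).det ≤ C' := by
    refine (le_abs_self _).trans (hC' _ ?_)
    rw [mem_closedBall_zero_iff]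
    refine (ContinuousLinearMap.opNorm_comp_le _ _).trans ?_
    rw [LinearIsometryEquiv.norm_map]
    exact mul_le_mul h'.1 h'.1 (norm_nonneg _) hR'
  have hu := S.isUnit_metric hζ
  have q2 : 1 ≤ (S.metric ζ).det * C := by
    have e1 : (S.metric ζ) ∘L (S.pinv ζ ∘L (S.pinv ζ).adjoint) = ContinuousLinearMap.id ℝ _ := by
      have a1 : S.pinv ζ ∘L S.jac ζ = ContinuousLinearMap.id ℝ _ := S.pinv_comp_jac hζ
      have a2 : S.metric ζ ∘L S.pinv ζ = (S.jac ζ).adjoint := by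
        rw [S.pinv_eq, ← ContinuousLinearMap.comp_assoc]
        have : S.metric ζ ∘L Ring.inverse ((S.jac ζ).adjoint ∘L S.jac ζ) =
          ContinuousLinearMap.id ℝ _ := Ring.mul_inverse_cancel _ hu
        rw [this, ContinuousLinearMap.id_comp]
      rw [← ContinuousLinearMap.comp_assoc, a2, ← ContinuousLinearMap.adjoint_comp, a1]
      exact ContinuousLinearMap.adjoint_id
    have e2 : (S.metric ζ).det * (S.pinv ζ ∘L (S.pinv ζ).adjoint).det = 1 := by
      have : ((S.metric ζ) ∘L (S.pinv ζ ∘L (S.pinv ζ).adjoint)).det = 1 := by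
        rw [e1]
        exact LinearMap.det_id
      rw [← this]
      exact (LinearMap.det_comp _ _).symm
    rw [← e2]
    refine mul_le_mul_of_nonneg_left ((le_abs_self _).trans (hC _ ?_)) (S.det_metric_pos hζ).le
    rw [mem_closedBall_zero_iff]
    refine (ContinuousLinearMap.opNorm_comp_le _ _).trans ?_
    rw [LinearIsometryEquiv.norm_map]
    exact mul_le_mul h.2.1 h.2.1 (norm_nonneg _) hR
  have hC0 : 0 ≤ C' := (S'.det_metric_pos hζ).le.trans q1
  simp only [Pi.smul_apply, smul_eq_mul]
  rw [← ENNReal.ofReal.eq_1, ← ENNReal.ofReal_mul (Real.sqrt_nonneg _),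
    ← Real.sqrt_mul' _ (S.det_metric_pos hζ).le]
  refine ENNReal.ofReal_le_ofReal (Real.sqrt_le_sqrt ?_)
  nlinarith [mul_le_mul_of_nonneg_left q2 hC0]

end W2Patch

/-- The matrix of a linear map of `ℝ^n`, in the space of matrices with the Frobenius inner
product. -/
def frob {n : ℕ} : (E n →L[ℝ] E n) →ₗ[ℝ] EuclideanSpace ℝ (Fin n × Fin n) where
  toFun A := WithLp.toLp 2 fun p => A (EuclideanSpace.single p.2 1) p.1
  map_add' A B := by ext p; simp
  map_smul' c A := by ext p; simp

theorem frob_injective {n : ℕ} : Function.Injective (frob (n := n)) := by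
  refine (injective_iff_map_eq_zero _).2 fun A hA => ?_
  have : (A : E n →ₗ[ℝ] E n) = 0 := by
    refine (EuclideanSpace.basisFun (Fin n) ℝ).toBasis.ext fun i => ?_
    ext j
    have := congrArg (fun v : EuclideanSpace ℝ (Fin n × Fin n) => v (j, i)) hA
    simpa [frob] using this
  exact ContinuousLinearMap.coe_injective this

theorem frob_bounds (n : ℕ) : ∃ c : ℝ, 0 ≤ c ∧ ∀ A : E n →L[ℝ] E n,
    ‖frob A‖ ≤ c * ‖A‖ ∧ ‖A‖ ≤ c * ‖frob A‖ := by
  obtain ⟨K, -, hK⟩ := LinearMap.exists_antilipschitzWith (frob (n := n))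
    (LinearMap.ker_eq_bot.2 frob_injective)
  let L := LinearMap.toContinuousLinearMap (frob (n := n))
  refine ⟨‖L‖ + K, by positivity, fun A => ⟨?_, ?_⟩⟩
  · have : ‖frob A‖ ≤ ‖L‖ * ‖A‖ := L.le_opNorm A
    refine this.trans (mul_le_mul_of_nonneg_right ?_ (norm_nonneg _))
    simp
  · have := hK.le_mul_dist A 0
    simp only [dist_zero_right, map_zero] at this
    exact this.trans (mul_le_mul_of_nonneg_right (le_add_of_nonneg_left (norm_nonneg L))
      (norm_nonneg _))

namespace Patch

variable {d : ℕ} {Ω : Opens (E d)} (S : Patch d Ω)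

namespace HasSurfaceGrad

variable {S} {V : Type*} [NormedAddCommGroup V] [NormedSpace ℝ V]
  {v w : E (d + 1) → V} {G H : E (d + 1) → E (d + 1) →L[ℝ] V}

theorem congr (h : S.HasSurfaceGrad v G) (hvw : v =ᵐ[S.area] w) : S.HasSurfaceGrad w G := by
  obtain ⟨D, hD, hG⟩ := h
  exact ⟨D, hD.congr (S.ae_area.1 hvw) (EventuallyEq.refl _ _), hG⟩

theorem add (hv : S.HasSurfaceGrad v G) (hw : S.HasSurfaceGrad w H) :
    S.HasSurfaceGrad (fun x => v x + w x) (fun x => G x + H x) := by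
  obtain ⟨D, hD, hG⟩ := hv
  obtain ⟨D', hD', hH⟩ := hw
  refine ⟨_, hD.add hD', ?_⟩
  filter_upwards [hG, hH] with ζ h1 h2
  rw [h1, h2, ContinuousLinearMap.add_comp]

theorem const_smul [CompleteSpace V] (hv : S.HasSurfaceGrad v G) (c : ℝ) :
    S.HasSurfaceGrad (fun x => c • v x) (fun x => c • G x) := by
  obtain ⟨D, hD, hG⟩ := hv
  refine ⟨_, hD.const_smul c, ?_⟩
  filter_upwards [hG] with ζ h1
  rw [h1, ContinuousLinearMap.smul_comp]

theorem unique [CompleteSpace V] (hv : S.HasSurfaceGrad v G) (hw : S.HasSurfaceGrad w H) (hvw : v =ᵐ[S.area] w) :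
    G =ᵐ[S.area] H := by
  obtain ⟨D, hD, hG⟩ := hv
  obtain ⟨D', hD', hH⟩ := hw
  refine S.ae_area.2 ?_
  filter_upwards [hG, hH, hD.unique hD' (S.ae_area.1 hvw)] with ζ h1 h2 h3
  rw [h1, h2, h3]

end HasSurfaceGrad

/-- `L²(M, ℝ^r)`. -/
abbrev L2 (r : ℕ) := Lp (E r) 2 S.area

/-- The space `H¹(M)` of vector fields `u = P_τ u + P_n u` on `M` with the inner product
`⟨u₁, u₂⟩_{L²} + ⟨U₁, U₂⟩_{L²}`, where `U = P_τ ∇(P_τ u) + P_n ∇(P_n u)` and matrices carry the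
Frobenius inner product. Its elements are the pairs `(u, U)`; `u` determines `U`. -/
def H1 : Submodule ℝ
    (WithLp 2 (S.L2 (d + 1) × Lp (EuclideanSpace ℝ (Fin (d + 1) × Fin (d + 1))) 2 S.area)) where
  carrier := {p | ∃ Gt Gn : E (d + 1) → E (d + 1) →L[ℝ] E (d + 1),
    S.HasSurfaceGrad (fun x => S.projT x (p.fst x)) Gt ∧
    S.HasSurfaceGrad (fun x => S.projN x (p.fst x)) Gn ∧
    p.snd =ᵐ[S.area] fun x => frob (S.projT x ∘L Gt x + S.projN x ∘L Gn x)}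
  zero_mem' := by
    have h0 : ∀ᵐ x ∂S.area, ((0 : S.L2 (d + 1)) : E (d + 1) → E (d + 1)) x = 0 :=
      Lp.coeFn_zero _ _ _
    have hz : S.HasSurfaceGrad (fun _ => (0 : E (d + 1))) (fun _ => 0) :=
      ⟨_, HasWeakDeriv.zero, Eventually.of_forall fun ζ => by simp⟩
    refine ⟨_, _, hz.congr ?_, hz.congr ?_, ?_⟩
    · filter_upwards [h0] with x hx
      change 0 = S.projT x ((0 : S.L2 (d + 1)) x)
      rw [hx, map_zero]
    · filter_upwards [h0] with x hx
      change 0 = S.projN x ((0 : S.L2 (d + 1)) x)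
      rw [hx, map_zero]
    · have h1 := Lp.coeFn_zero (EuclideanSpace ℝ (Fin (d + 1) × Fin (d + 1))) 2 S.area
      filter_upwards [h1] with x hx
      refine Eq.trans hx ?_
      simp
  add_mem' := by
    rintro p q ⟨Gt, Gn, h1, h2, h3⟩ ⟨Ht, Hn, k1, k2, k3⟩
    have e1 := Lp.coeFn_add p.fst q.fst
    have e2 := Lp.coeFn_add p.snd q.snd
    refine ⟨_, _, (h1.add k1).congr ?_, (h2.add k2).congr ?_, ?_⟩
    · filter_upwards [e1] with x hx
      rw [WithLp.add_fst, hx, Pi.add_apply, map_add]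
    · filter_upwards [e1] with x hx
      rw [WithLp.add_fst, hx, Pi.add_apply, map_add]
    · filter_upwards [e2, h3, k3] with x hx hx3 hk3
      rw [WithLp.add_snd, hx, Pi.add_apply, hx3, hk3, ← map_add]
      simp only [ContinuousLinearMap.comp_add]
      congr 1
      abel
  smul_mem' := by
    rintro c p ⟨Gt, Gn, h1, h2, h3⟩
    have e1 := Lp.coeFn_smul c p.fst
    have e2 := Lp.coeFn_smul c p.snd
    refine ⟨_, _, (h1.const_smul c).congr ?_, (h2.const_smul c).congr ?_, ?_⟩
    · filter_upwards [e1] with x hx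
      rw [WithLp.smul_fst, hx, Pi.smul_apply, map_smul]
    · filter_upwards [e1] with x hx
      rw [WithLp.smul_fst, hx, Pi.smul_apply, map_smul]
    · filter_upwards [e2, h3] with x hx hx3
      rw [WithLp.smul_snd, hx, Pi.smul_apply, hx3, ← map_smul]
      simp only [ContinuousLinearMap.comp_smul, smul_add]

/-- The vector field underlying an element of `H¹(M)`. -/
def H1.field {S : Patch d Ω} (u : S.H1) : S.L2 (d + 1) := u.1.fst

theorem H1.ext {S : Patch d Ω} {u v : S.H1} (h : H1.field u = H1.field v) : u = v := by
  obtain ⟨p, Gt, Gn, h1, h2, h3⟩ := u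
  obtain ⟨q, Ht, Hn, k1, k2, k3⟩ := v
  have hpq : p.fst = q.fst := h
  rw [hpq] at h1 h2
  refine Subtype.ext (WithLp.ofLp_injective 2 (Prod.ext hpq (Lp.ext ?_)))
  change p.snd =ᵐ[S.area] q.snd
  filter_upwards [h3, k3, h1.unique k1 (EventuallyEq.refl _ _),
    h2.unique k2 (EventuallyEq.refl _ _)] with x a1 a2 a3 a4
  rw [a1, a2, a3, a4]

/-- `T v = v ∘ m ∘ (m')⁻¹`, which takes functions on `M = m(Ω)` to functions on
`M' = m'(Ω)`. -/
def transfer {V : Type*} (S S' : Patch d Ω) (v : E (d + 1) → V) : E (d + 1) → V :=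
  fun x => v (S.m (S'.inv x))

theorem ae_transfer {S : Patch d Ω} (S' : Patch d Ω) {p : E (d + 1) → Prop}
    (h : ∀ᵐ x ∂S.area, p x) : ∀ᵐ x ∂S'.area, p (S.m (S'.inv x)) := by
  refine S'.ae_area.2 ?_
  filter_upwards [S.ae_area.1 h, ae_restrict_mem measurableSet_dom] with ζ hζ hm
  rwa [S'.inv_m hm]

theorem continuousOn_pinv : ContinuousOn S.pinv Ω := by
  intro ζ hζ
  obtain ⟨u, hu⟩ := S.isUnit_metric hζ
  have h1 : ContinuousWithinAt (fun ζ => Ring.inverse (S.metric ζ)) Ω ζ := by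
    have := (contDiffAt_ringInverse (n := 0) ℝ u).continuousAt
    rw [hu] at this
    exact this.comp_continuousWithinAt (S.continuousOn_metric ζ hζ)
  have h2 : ContinuousWithinAt (fun ζ => (S.jac ζ).adjoint) Ω ζ :=
    (adjoint_bdd.contDiff (n := 0)).continuous.continuousAt.comp_continuousWithinAt
      (S.continuousOn_jac ζ hζ)
  have h3 : S.pinv = fun ζ => Ring.inverse (S.metric ζ) ∘L (S.jac ζ).adjoint := by
    ext1 ζ
    exact S.pinv_eq ζ
  rw [h3]
  exact h1.clm_comp h2

end Patch

namespace W2Patch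

variable {d : ℕ} {Ω : Opens (E d)} (S : W2Patch d Ω)

/-- If `u ∈ H¹(M)` then `u ∘ m` has a weak derivative that is controlled by `u`. -/
theorem exists_deriv : ∃ K : ℝ, 0 ≤ K ∧ ∀ u : S.H1, ∃ D : E d → E d →L[ℝ] E (d + 1),
    HasWeakDeriv Ω (fun ζ => Patch.H1.field u (S.m ζ)) D ∧
    ∀ᵐ ζ ∂(volume.restrict (Ω : Set (E d))),
      ‖D ζ‖ ≤ K * (‖u.1.snd (S.m ζ)‖ + ‖Patch.H1.field u (S.m ζ)‖) := by
  obtain ⟨R, _, hR, _, hb⟩ := S.exists_bounds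
  obtain ⟨C, hC, hproj⟩ := S.exists_proj
  obtain ⟨c, hc, hfrob⟩ := frob_bounds (d + 1)
  refine ⟨c * R + 2 * C, by positivity, ?_⟩
  rintro ⟨p, Gt, Gn, ⟨Dt, hDt, et⟩, ⟨Dn, hDn, en⟩, h3⟩
  have hD := (hDt.add hDn).congr (g := fun ζ => p.fst (S.m ζ))
    (Eventually.of_forall fun ζ => by simp [S.projN_eq]) (EventuallyEq.refl _ _)
  refine ⟨_, hD, ?_⟩
  obtain ⟨G, hGt, hGn, hG⟩ := hproj _ _ hD
  have u1 := hDt.unique hGt (EventuallyEq.refl _ _)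
  have u2 := hDn.unique hGn (EventuallyEq.refl _ _)
  filter_upwards [hb, et, en, S.ae_area.1 h3, hG, u1, u2,
    ae_restrict_mem Patch.measurableSet_dom] with ζ b1 b2 b3 b4 b5 b6 b7 hζ
  change ‖Dt ζ + Dn ζ‖ ≤ _ * (‖p.snd (S.m ζ)‖ + ‖p.fst (S.m ζ)‖)
  rw [b4, b2, b3]
  set P := S.projT (S.m ζ) with hP
  set N := S.projN (S.m ζ) with hN
  set U := P ∘L Dt ζ ∘L S.pinv ζ + N ∘L Dn ζ ∘L S.pinv ζ with hU
  have hPN : N = ContinuousLinearMap.id ℝ _ - P := S.projN_eq _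
  have hPP : P ∘L P = P := S.projT_projT _
  have hUJ : U ∘L S.jac ζ = P ∘L Dt ζ + N ∘L Dn ζ := by
    rw [hU, ContinuousLinearMap.add_comp]
    simp only [ContinuousLinearMap.comp_assoc]
    rw [S.pinv_comp_jac hζ]
    simp
  rw [← b6] at b5
  set Q := Dt ζ - P ∘L (Dt ζ + Dn ζ) with hQ
  have hmain : Dt ζ + Dn ζ = U ∘L S.jac ζ - (P ∘L Q - N ∘L Q) := by
    rw [hUJ, hPN, hQ]
    ext1 v
    have hv : ∀ y, P (P y) = P y := fun y => congrArg (fun T : E (d + 1) →L[ℝ] E (d + 1) => T y) hPP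
    simp only [add_apply, sub_apply, ContinuousLinearMap.comp_apply, map_add, map_sub, hv,
      ContinuousLinearMap.id_apply]
    abel_nf
    try module
  rw [hmain]
  have n1 : ‖U ∘L S.jac ζ‖ ≤ c * ‖frob U‖ * R :=
    (ContinuousLinearMap.opNorm_comp_le _ _).trans
      (mul_le_mul (hfrob U).2 b1.1 (norm_nonneg _) (by positivity))
  have n2 : ‖P ∘L Q‖ ≤ C * ‖p.fst (S.m ζ)‖ := by
    refine (ContinuousLinearMap.opNorm_comp_le _ _).trans ?_
    have := mul_le_mul (S.projT_norm (S.m ζ)) b5 (norm_nonneg _) zero_le_one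
    rwa [one_mul] at this
  have n3 : ‖N ∘L Q‖ ≤ C * ‖p.fst (S.m ζ)‖ := by
    refine (ContinuousLinearMap.opNorm_comp_le _ _).trans ?_
    have := mul_le_mul (S.projN_norm (S.m ζ)) b5 (norm_nonneg _) zero_le_one
    rwa [one_mul] at this
  have n4 := norm_sub_le (U ∘L S.jac ζ) (P ∘L Q - N ∘L Q)
  have n5 := norm_sub_le (P ∘L Q) (N ∘L Q)
  have n6 : 0 ≤ C * ‖frob U‖ := by positivity
  have n7 : 0 ≤ c * R * ‖p.fst (S.m ζ)‖ := by positivity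
  have n8 : (c * R + 2 * C) * (‖frob U‖ + ‖p.fst (S.m ζ)‖) = c * ‖frob U‖ * R +
      C * ‖p.fst (S.m ζ)‖ + C * ‖p.fst (S.m ζ)‖ + c * R * ‖p.fst (S.m ζ)‖ + 2 * (C * ‖frob U‖) := by
    ring
  rw [n8]
  linarith

/-- `T` maps `H¹(M)` to `H¹(M')`. -/
theorem exists_transfer (S' : W2Patch d Ω) (u : S.H1) : ∃ w : S'.H1,
    Patch.H1.field w =ᵐ[S'.area]
      Patch.transfer S.toPatch S'.toPatch (Patch.H1.field u) := by
  obtain ⟨R, _, hR, _, hb⟩ := S'.exists_bounds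
  obtain ⟨C, hC, hproj⟩ := S'.exists_proj
  obtain ⟨c, hc, hfrob⟩ := frob_bounds (d + 1)
  obtain ⟨K, hK, hder⟩ := S.exists_deriv
  obtain ⟨κ, hκ⟩ := S.exists_param_le S'
  obtain ⟨D, hD, hDb⟩ := hder u
  obtain ⟨G, hGt, hGn, hG⟩ := hproj _ _ hD
  let U := u.1.snd
  have m1 : MemLp (fun ζ => Patch.H1.field u (S.m ζ)) 2 S'.param :=
    (S.memLp_param (Lp.memLp (Patch.H1.field u))).of_measure_le_smul (c := κ)
      ENNReal.coe_ne_top hκ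
  have m2 : MemLp (fun ζ => U (S.m ζ)) 2 S'.param :=
    (S.memLp_param (Lp.memLp U)).of_measure_le_smul (c := κ) ENNReal.coe_ne_top hκ
  let w0 : E (d + 1) → E (d + 1) := Patch.transfer S.toPatch S'.toPatch (Patch.H1.field u)
  have hw0 : ∀ ζ ∈ Ω, w0 (S'.m ζ) = Patch.H1.field u (S.m ζ) := by
    intro ζ hζ
    simp only [w0, Patch.transfer, S'.inv_m hζ]
  have mw0 : MemLp w0 2 S'.area := by
    refine S'.memLp_area (m1.ae_eq (S'.ae_param.2 ?_))
    filter_upwards [ae_restrict_mem Patch.measurableSet_dom] with ζ hζ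
    exact (hw0 ζ hζ).symm
  let g1 : E (d + 1) → E (d + 1) →L[ℝ] E (d + 1) := fun x => G (S'.inv x) ∘L S'.pinv (S'.inv x)
  let g2 : E (d + 1) → E (d + 1) →L[ℝ] E (d + 1) :=
    fun x => (D (S'.inv x) - G (S'.inv x)) ∘L S'.pinv (S'.inv x)
  let h : E (d + 1) → EuclideanSpace ℝ (Fin (d + 1) × Fin (d + 1)) :=
    fun x => frob (S'.projT x ∘L g1 x + S'.projN x ∘L g2 x)
  have hhm : ∀ ζ ∈ Ω, h (S'.m ζ) = frob (S'.projT (S'.m ζ) ∘L G ζ ∘L S'.pinv ζ +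
      S'.projN (S'.m ζ) ∘L (D ζ - G ζ) ∘L S'.pinv ζ) := by
    intro ζ hζ
    simp only [h, g1, g2, S'.inv_m hζ]
  have meas : AEStronglyMeasurable (fun ζ => h (S'.m ζ)) (volume.restrict (Ω : Set (E d))) := by
    have s1 : AEStronglyMeasurable G (volume.restrict (Ω : Set (E d))) :=
      hGt.locInt'.aestronglyMeasurable
    have s2 : AEStronglyMeasurable D (volume.restrict (Ω : Set (E d))) :=
      hD.locInt'.aestronglyMeasurable
    have s3 : AEStronglyMeasurable S'.pinv (volume.restrict (Ω : Set (E d))) :=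
      S'.continuousOn_pinv.aestronglyMeasurable Patch.measurableSet_dom
    have s4 : AEStronglyMeasurable (fun ζ => gramProj (S'.jac ζ))
        (volume.restrict (Ω : Set (E d))) :=
      (contDiffOn_gramProj.continuousOn.comp S'.continuousOn_jac
        fun ζ hζ => S'.isUnit_metric hζ).aestronglyMeasurable Patch.measurableSet_dom
    have cc : Continuous fun p : (E d →L[ℝ] E (d + 1)) × (E d →L[ℝ] E (d + 1)) ×
        (E (d + 1) →L[ℝ] E d) × (E (d + 1) →L[ℝ] E (d + 1)) =>
        frob (p.2.2.2 ∘L p.1 ∘L p.2.2.1 +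
          (ContinuousLinearMap.id ℝ _ - p.2.2.2) ∘L (p.2.1 - p.1) ∘L p.2.2.1) := by
      refine (LinearMap.continuous_of_finiteDimensional frob).comp ?_
      fun_prop
    refine (cc.comp_aestronglyMeasurable (s1.prodMk (s2.prodMk (s3.prodMk s4)))).congr ?_
    filter_upwards [ae_restrict_mem Patch.measurableSet_dom] with ζ hζ
    rw [hhm ζ hζ, S'.projN_eq, S'.projT_m hζ]
  have mh : MemLp h 2 S'.area := by
    refine S'.memLp_area ?_
    have meas' : AEStronglyMeasurable (fun ζ => h (S'.m ζ)) S'.param :=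
      meas.mono_ac (withDensity_absolutelyContinuous _ _)
    refine ((m2.norm.add m1.norm).const_mul (c * ((2 * K + 2 * C) * R))).mono' meas' ?_
    refine S'.ae_param.2 ?_
    filter_upwards [hb, hDb, hG, ae_restrict_mem Patch.measurableSet_dom] with ζ b1 b2 b3 hζ
    rw [hhm ζ hζ]
    simp only [Pi.add_apply]
    set a := ‖Patch.H1.field u (S.m ζ)‖ with ha
    set b := ‖U (S.m ζ)‖ with hb
    set P := S'.projT (S'.m ζ)
    set N := S'.projN (S'.m ζ)
    have ha0 : 0 ≤ a := norm_nonneg _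
    have hb0 : 0 ≤ b := norm_nonneg _
    have hPN : N = ContinuousLinearMap.id ℝ _ - P := S'.projN_eq _
    have hD' : ‖D ζ‖ ≤ K * (b + a) := b2
    have q1 : ‖G ζ‖ ≤ ‖D ζ‖ + C * a := by
      have t1 : ‖P ∘L D ζ‖ ≤ ‖D ζ‖ := by
        refine (ContinuousLinearMap.opNorm_comp_le _ _).trans ?_
        exact mul_le_of_le_one_left (norm_nonneg _) (S'.projT_norm _)
      have t2 := norm_add_le (P ∘L D ζ) (G ζ - P ∘L D ζ)
      rw [add_sub_cancel] at t2
      linarith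
    have q2 : ‖D ζ - G ζ‖ ≤ ‖D ζ‖ + C * a := by
      have t0 : D ζ - G ζ = N ∘L D ζ - (G ζ - P ∘L D ζ) := by
        rw [hPN, ContinuousLinearMap.sub_comp, ContinuousLinearMap.id_comp]
        abel
      have t1 : ‖N ∘L D ζ‖ ≤ ‖D ζ‖ := by
        refine (ContinuousLinearMap.opNorm_comp_le _ _).trans ?_
        exact mul_le_of_le_one_left (norm_nonneg _) (S'.projN_norm _)
      have t2 := norm_sub_le (N ∘L D ζ) (G ζ - P ∘L D ζ)
      rw [← t0] at t2
      linarith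
    have q3 : ∀ (T : E (d + 1) →L[ℝ] E (d + 1)) (Y : E d →L[ℝ] E (d + 1)), ‖T‖ ≤ 1 →
        ‖Y‖ ≤ ‖D ζ‖ + C * a → ‖T ∘L Y ∘L S'.pinv ζ‖ ≤ (‖D ζ‖ + C * a) * R := by
      intro T Y hT hY
      refine (ContinuousLinearMap.opNorm_comp_le _ _).trans ?_
      refine (mul_le_of_le_one_left (norm_nonneg _) hT).trans ?_
      refine (ContinuousLinearMap.opNorm_comp_le _ _).trans ?_
      exact mul_le_mul hY b1.2.1 (norm_nonneg _) (by positivity)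
    refine (hfrob _).1.trans ?_
    rw [mul_assoc]
    refine mul_le_mul_of_nonneg_left ?_ hc
    refine (norm_add_le _ _).trans ?_
    have r1 := q3 P (G ζ) (S'.projT_norm _) q1
    have r2 := q3 N (D ζ - G ζ) (S'.projN_norm _) q2
    refine (add_le_add r1 r2).trans ?_
    have r3 : ‖D ζ‖ + C * a ≤ (K + C) * (b + a) := by
      rw [add_mul, mul_add C]
      linarith [mul_nonneg hC hb0]
    have r4 := mul_le_mul_of_nonneg_right r3 hR
    have r5 : (2 * K + 2 * C) * R * (b + a) = (K + C) * (b + a) * R + (K + C) * (b + a) * R := by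
      ring
    rw [r5]
    exact add_le_add r4 r4
  have e1 := mw0.coeFn_toLp
  have e2 := mh.coeFn_toLp
  have k1 : (w0 ∘ S'.m) =ᵐ[volume.restrict (Ω : Set (E d))] fun ζ => Patch.H1.field u (S.m ζ) := by
    filter_upwards [ae_restrict_mem Patch.measurableSet_dom] with ζ hζ
    exact hw0 ζ hζ
  refine ⟨⟨WithLp.toLp 2 (mw0.toLp w0, mh.toLp h), g1, g2, ?_, ?_, ?_⟩, e1⟩
  · have hs : S'.HasSurfaceGrad (fun x => S'.projT x (w0 x)) g1 := by
      refine ⟨G, hGt.congr ?_ (EventuallyEq.refl _ _), ?_⟩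
      · filter_upwards [k1] with ζ hζ
        simp only [Function.comp_def] at hζ ⊢
        rw [hζ]
      · filter_upwards [ae_restrict_mem Patch.measurableSet_dom] with ζ hζ
        simp only [g1, S'.inv_m hζ]
    refine hs.congr ?_
    filter_upwards [e1] with x hx
    change _ = S'.projT x (mw0.toLp w0 x)
    rw [hx]
  · have hs : S'.HasSurfaceGrad (fun x => S'.projN x (w0 x)) g2 := by
      refine ⟨fun ζ => D ζ - G ζ, hGn.congr ?_ (EventuallyEq.refl _ _), ?_⟩
      · filter_upwards [k1] with ζ hζ
        simp only [Function.comp_def] at hζ ⊢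
        rw [hζ]
      · filter_upwards [ae_restrict_mem Patch.measurableSet_dom] with ζ hζ
        simp only [g2, S'.inv_m hζ]
    refine hs.congr ?_
    filter_upwards [e1] with x hx
    change _ = S'.projN x (mw0.toLp w0 x)
    rw [hx]
  · exact e2

/-- The transfer `T : H¹(M) → H¹(M')`, `T u = u ∘ m ∘ (m')⁻¹`. -/
def transferH1 (S S' : W2Patch d Ω) : S.H1 →ₗ[ℝ] S'.H1 where
  toFun u := (S.exists_transfer S' u).choose
  map_add' u v := by
    refine Patch.H1.ext (Lp.ext ?_)
    have hu := (S.exists_transfer S' u).choose_spec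
    have hv := (S.exists_transfer S' v).choose_spec
    have huv := (S.exists_transfer S' (u + v)).choose_spec
    have e1 := Lp.coeFn_add (Patch.H1.field (S.exists_transfer S' u).choose)
      (Patch.H1.field (S.exists_transfer S' v).choose)
    have e2 := Patch.ae_transfer S'.toPatch (Lp.coeFn_add (Patch.H1.field u) (Patch.H1.field v))
    filter_upwards [hu, hv, huv, e1, e2] with x a1 a2 a3 a4 a5
    rw [a3]
    refine Eq.trans ?_ (id a4.symm :)
    rw [Pi.add_apply, a1, a2]
    exact a5
  map_smul' c u := by
    refine Patch.H1.ext (Lp.ext ?_)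
    have hu := (S.exists_transfer S' u).choose_spec
    have huv := (S.exists_transfer S' (c • u)).choose_spec
    have e1 := Lp.coeFn_smul c (Patch.H1.field (S.exists_transfer S' u).choose)
    have e2 := Patch.ae_transfer S'.toPatch (Lp.coeFn_smul c (Patch.H1.field u))
    filter_upwards [hu, huv, e1, e2] with x a1 a3 a4 a5
    rw [a3]
    refine Eq.trans ?_ a4.symm
    rw [Pi.smul_apply, a1]
    exact a5

theorem transferH1_spec (S S' : W2Patch d Ω) (u : S.H1) :
    Patch.H1.field (transferH1 S S' u) =ᵐ[S'.area]
      Patch.transfer S.toPatch S'.toPatch (Patch.H1.field u) :=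
  (S.exists_transfer S' u).choose_spec

end W2Patch

/-- The norm of the linear operator `u ↦ A u`, where `A u` has the norm `N u`: the supremum of `N`
over the unit ball, with the value `∞` for an unbounded operator. -/
def supUnitBall {X : Type*} [SeminormedAddCommGroup X] (N : X → ℝ≥0∞) : ℝ≥0∞ :=
  ⨆ (u : X) (_ : ‖u‖ ≤ 1), N u

/-- The norm of `L²(M)`. -/
def Patch.L2Norm {d r : ℕ} {Ω : Opens (E d)} (S : Patch d Ω) (v : E (d + 1) → E r) : ℝ≥0∞ :=
  eLpNorm v 2 S.area

section Perturbation

variable {d₁ d₂ r : ℕ} {Ω₁ : Opens (E d₁)} {Ω₂ : Opens (E d₂)}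
  (M₁ : ℝ≥0 → W2Patch d₁ Ω₁) (M₂ : ℝ≥0 → Patch d₂ Ω₂)
  (F : ∀ σ : ℝ≥0, (M₁ σ).H1 →L[ℝ] (M₂ σ).L2 r)

/-- `γ₁(σ) = ‖m_{1,σ} - m₁‖_{W^{2,∞}(Ω₁)}`. -/
def gamma (σ : ℝ≥0) : ℝ≥0∞ := W2InfNorm Ω₁ fun ζ => (M₁ σ).m ζ - (M₁ 0).m ζ

/-- `(T_{2,σ}⁻¹ F_σ T_{1,σ} - F) u`. -/
def opDiff (σ : ℝ≥0) (u : (M₁ 0).H1) : E (d₂ + 1) → E r := fun x =>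
  Patch.transfer (M₂ σ) (M₂ 0) (F σ ((M₁ 0).transferH1 (M₁ σ) u)) x - F 0 u x

/-- `(T_{1,σ}⁻¹ P_{n,σ} T_{1,σ} - P_n) u`. -/
def normalDiff (σ : ℝ≥0) (u : (M₁ 0).H1) : E (d₁ + 1) → E (d₁ + 1) := fun x =>
  Patch.transfer (M₁ σ).toPatch (M₁ 0).toPatch
      (fun y => (M₁ σ).projN y (Patch.H1.field ((M₁ 0).transferH1 (M₁ σ) u) y)) x
    - (M₁ 0).projN x (Patch.H1.field u x)

/-- `ρ(σ) = ‖T_{2,σ}⁻¹ F_σ T_{1,σ} - F‖`, for operators from `H¹(M₁)` to `L²(M₂)`. -/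
def rho (σ : ℝ≥0) : ℝ≥0∞ := supUnitBall fun u => (M₂ 0).L2Norm (opDiff M₁ M₂ F σ u)

/-- `ρᵃ(σ)`, the norm of the difference of `(T_{2,σ}⁻¹ F_σ T_{1,σ}, T_{1,σ}⁻¹ P_{n,σ} T_{1,σ})` and
`(F, P_n)`, as operators from `H¹(M₁)` to the Hilbert space `L²(M₂) × L²(M₁)`. -/
def rhoAmbient (σ : ℝ≥0) : ℝ≥0∞ :=
  supUnitBall fun u => ((M₂ 0).L2Norm (opDiff M₁ M₂ F σ u) ^ 2
    + (M₁ 0).L2Norm (normalDiff M₁ σ u) ^ 2) ^ (1 / 2 : ℝ)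

end Perturbation

end SurfacePert

end

open SurfacePert

/-! The two components of the operator can be estimated separately, because the Hilbert norm of a
pair is at most the sum of the norms of its entries. The first component contributes exactly `rho`,
so everything rests on bounding the second component by a multiple of `gamma`.

In the parameter domain the transfers cancel. If `A` and `B` are the Jacobians of the
parametrizations of `M₁ 0` and `M₁ σ` at `ζ`, then `T⁻¹ P_{n,σ} T - P_n` multiplies the value of `u`
at `ζ` by the matrix `Q_B - Q_A`, where `Q` denotes the orthogonal projection onto the complement of
the range (`normalDiff_m`). Both terms live on the fixed surface `M₁ 0`, so no area elements have to
be compared, and no derivative of `u` enters. The norm of this multiplication operator on `L²` is at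
most the essential supremum of `‖Q_B - Q_A‖`, and the `L²` norm is at most the `H¹` norm.

What remains is linear algebra. With `P = 1 - Q` one has `Q_B - Q_A = P_A Q_B - Q_A P_B`. A product
such as `Q_A P_B` is small since `Q_A` kills `A x`, so that `Q_A B x = Q_A (B - A) x`; a lower bound
of `B` controls `x` by `B x`. This makes the projection Lipschitz in the Jacobian
(`norm_starProjection_orthogonal_range_sub_le`).

The lower bound of `A` is the essential bound of the pseudoinverse `∂m†`, which is the surface
gradient of `m⁻¹`. No bound of the inverse parametrizations is assumed to be uniform in `σ`; for
small `gamma` the lower bound of `B` is inherited from that of `A` at the cost of a factor 2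
(`norm_le_two_mul_of_norm_sub_le`). Finally `‖A - B‖` is at most `gamma` almost everywhere, because
the classical Jacobians are also the weak ones (`Patch.LInfNorm_jac_sub_le`). -/

namespace SurfacePert

/-! ### Perturbation of orthogonal projections onto ranges -/

/-- The product of the projection onto `(range A)ᗮ` and the projection onto `range B` is small if
`A` is close to `B` and `B` is bounded from below. -/
theorem norm_orthogonal_comp_starProjection_le {d n : ℕ} {A B : E d →L[ℝ] E n} {R : ℝ}
    (hR : 0 ≤ R) (hB : ∀ x, ‖x‖ ≤ R * ‖B x‖) :
    ‖A.rangeᗮ.starProjection ∘L B.range.starProjection‖ ≤ R * ‖A - B‖ := by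
  refine ContinuousLinearMap.opNorm_le_bound _ (by positivity) fun y => ?_
  -- A preimage `x` of the projected vector is what allows `A` and `B` to be compared: `A x` is
  -- invisible to the outer projection, so only `(B - A) x` survives, and `‖x‖ ≤ R * ‖B x‖ ≤ R *
  -- ‖y‖`.
  obtain ⟨x, hx⟩ : B.range.starProjection y ∈ B.range := Submodule.starProjection_apply_mem _ y
  replace hx : B x = B.range.starProjection y := hx
  have hAx : A.rangeᗮ.starProjection (A x) = 0 :=
    Submodule.starProjection_orthogonal_apply_eq_zero ⟨x, rfl⟩
  have hle : ‖B x‖ ≤ ‖y‖ := by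
    rw [hx]
    exact Submodule.norm_starProjection_apply_le _ y
  have e : A.rangeᗮ.starProjection (B.range.starProjection y) =
      A.rangeᗮ.starProjection ((B - A) x) := by
    rw [← hx, sub_apply, map_sub, hAx, sub_zero]
  rw [ContinuousLinearMap.comp_apply, e]
  calc _ ≤ ‖(B - A) x‖ := Submodule.norm_starProjection_apply_le _ _
    _ ≤ ‖B - A‖ * ‖x‖ := ContinuousLinearMap.le_opNorm _ _
    _ ≤ ‖B - A‖ * (R * ‖y‖) := by
      gcongr
      exact (hB x).trans (mul_le_mul_of_nonneg_left hle hR)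
    _ = R * ‖A - B‖ * ‖y‖ := by rw [norm_sub_rev]; ring

/-- The orthogonal projection onto the range of a linear map depends Lipschitz continuously on the
map, locally uniformly with respect to lower bounds. -/
theorem norm_starProjection_orthogonal_range_sub_le {d n : ℕ} {A B : E d →L[ℝ] E n} {R R' : ℝ}
    (hR : 0 ≤ R) (hR' : 0 ≤ R') (hA : ∀ x, ‖x‖ ≤ R * ‖A x‖) (hB : ∀ x, ‖x‖ ≤ R' * ‖B x‖) :
    ‖B.rangeᗮ.starProjection - A.rangeᗮ.starProjection‖ ≤ (R + R') * ‖A - B‖ := by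
  -- This is `P_A - P_B = P_A (1 - P_B) - (1 - P_A) P_B`. Writing the first product as the adjoint
  -- of `Q_B P_A` puts both terms into the form of the preceding lemma, with the roles of `A` and
  -- `B` exchanged.
  have e : B.rangeᗮ.starProjection - A.rangeᗮ.starProjection =
      (B.rangeᗮ.starProjection ∘L A.range.starProjection).adjoint -
        A.rangeᗮ.starProjection ∘L B.range.starProjection := by
    have hs (K : Submodule ℝ (E n)) : K.starProjection.adjoint = K.starProjection :=
      (isSelfAdjoint_starProjection K).adjoint_eq
    rw [ContinuousLinearMap.adjoint_comp, hs, hs, Submodule.starProjection_orthogonal,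
      Submodule.starProjection_orthogonal]
    ext1 x
    simp
  rw [e, add_mul]
  refine (norm_sub_le _ _).trans (add_le_add ?_ (norm_orthogonal_comp_starProjection_le hR' hB))
  -- The adjoint is isometric, and the exchanged product is controlled by the lower bound of `A`.
  -- Hence each of the two constants appears once in the sum `R + R'`.
  rw [LinearIsometryEquiv.norm_map, norm_sub_rev]
  exact norm_orthogonal_comp_starProjection_le hR hA

/-- A lower bound of a linear map is stable under small perturbations. -/
theorem norm_le_two_mul_of_norm_sub_le {d n : ℕ} {A B : E d →L[ℝ] E n} {R : ℝ} (hR : 0 ≤ R)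
    (hA : ∀ x, ‖x‖ ≤ R * ‖A x‖) (h : R * ‖A - B‖ ≤ 1 / 2) (x : E d) :
    ‖x‖ ≤ 2 * R * ‖B x‖ := by
  have h1 : ‖A x‖ ≤ ‖A - B‖ * ‖x‖ + ‖B x‖ := by
    calc ‖A x‖ = ‖(A - B) x + B x‖ := by simp
      _ ≤ _ := (norm_add_le _ _).trans (by gcongr; exact ContinuousLinearMap.le_opNorm _ _)
  -- Combined with `hA` this gives `‖x‖ ≤ ‖x‖ / 2 + R * ‖B x‖`; absorbing half of `‖x‖` on the left
  -- produces the factor 2.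
  have h2 := mul_le_mul_of_nonneg_left h1 hR
  have h3 := mul_le_mul_of_nonneg_right h (norm_nonneg x)
  linarith [hA x]

/-! ### Jacobians, fields and normal projections in the parameter domain -/

theorem Patch.projN_m {d : ℕ} {Ω : Opens (E d)} (S : Patch d Ω) {ζ : E d} (hζ : ζ ∈ Ω) :
    S.projN (S.m ζ) = (S.jac ζ).rangeᗮ.starProjection := by
  simp only [projN, tangent, S.inv_m hζ]

/-- The `W^{2,∞}` distance of two parametrizations bounds the distance of their Jacobians. -/
theorem Patch.LInfNorm_jac_sub_le {d : ℕ} {Ω : Opens (E d)} (S S' : Patch d Ω) :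
    LInfNorm (volume.restrict Ω) (fun ζ => S'.jac ζ - S.jac ζ) ≤
      W2InfNorm Ω fun ζ => S'.m ζ - S.m ζ := by
  rw [W2InfNorm]
  -- The `W^{2,∞}` norm is an infimum over all choices of weak derivatives, so an arbitrary first
  -- derivative `f'` has to be treated. The difference is `C¹`, and uniqueness of weak derivatives
  -- identifies `f'` with its classical derivative almost everywhere; the norm of `f'` is one of the
  -- three nonnegative summands.
  refine le_iInf fun f' => le_iInf fun f'' => le_iInf fun hf => le_iInf fun _ => ?_
  have hw : HasWeakDeriv Ω (fun ζ => S'.m ζ - S.m ζ) (fderiv ℝ fun ζ => S'.m ζ - S.m ζ) :=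
    HasWeakDeriv.of_contDiffOn (S'.contDiffOn.sub S.contDiffOn)
  have e : (fun ζ => S'.jac ζ - S.jac ζ) =ᵐ[volume.restrict (Ω : Set (E d))] f' := by
    filter_upwards [hf.unique hw (EventuallyEq.refl _ _),
      ae_restrict_mem Patch.measurableSet_dom] with ζ h hζ
    have hd (T : Patch d Ω) : DifferentiableAt ℝ T.m ζ :=
      (T.contDiffOn.contDiffAt (Ω.isOpen.mem_nhds hζ)).differentiableAt (by simp)
    rw [h, fderiv_fun_sub (hd S') (hd S), jac, jac]
  rw [LInfNorm, eLpNorm_congr_ae e]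
  exact le_add_self.trans le_self_add

/-- The `H¹` norm is the Hilbert norm of the pair `(u, U)`, and dropping `U` cannot increase it.
This is how the `L²` estimate of the normal component becomes one on the unit ball of `H¹`. -/
theorem Patch.H1.norm_field_le {d : ℕ} {Ω : Opens (E d)} {S : Patch d Ω} (u : S.H1) :
    ‖Patch.H1.field u‖ ≤ ‖u‖ :=
  WithLp.norm_fst_le _ u.1

/-- Pointwise formula for `T⁻¹ P_{n,σ} T - P_n`. -/
theorem normalDiff_m {d : ℕ} {Ω : Opens (E d)} (M : ℝ≥0 → W2Patch d Ω) (σ : ℝ≥0) (u : (M 0).H1) :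
    ∀ᵐ ζ ∂(volume.restrict (Ω : Set (E d))), normalDiff M σ u ((M 0).m ζ) =
      (((M σ).jac ζ).rangeᗮ.starProjection - ((M 0).jac ζ).rangeᗮ.starProjection)
        (Patch.H1.field u ((M 0).m ζ)) := by
  -- The transferred field is an `L²` class, known only through its formula almost everywhere on the
  -- surface at `σ`. Null sets of that surface pull back to null sets of `Ω`, and there both
  -- transfers reduce to evaluation at the same `ζ`.
  filter_upwards [(M σ).ae_area.1 ((M 0).transferH1_spec (M σ) u),
    ae_restrict_mem Patch.measurableSet_dom] with ζ h hζ
  simp only [normalDiff, Patch.transfer, (M 0).inv_m hζ, h, (M σ).inv_m hζ,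
    Patch.projN_m _ hζ, sub_apply]

/-! ### The rate for the normal projections -/

/-- `‖T⁻¹ P_{n,σ} T - P_n‖ = O(γ)`. -/
theorem exists_L2Norm_normalDiff_le {d : ℕ} {Ω : Opens (E d)} (M : ℝ≥0 → W2Patch d Ω)
    (hγ : Tendsto (gamma M) (𝓝[>] 0) (𝓝 0)) :
    ∃ C : ℝ≥0, ∀ᶠ σ in 𝓝[>] 0, ∀ u : (M 0).H1, ‖u‖ ≤ 1 →
      (M 0).L2Norm (normalDiff M σ u) ≤ C * gamma M σ := by
  obtain ⟨R, hR, hb⟩ := (M 0).exists_pinv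
  -- Here `R` is the lower-bound constant of the unperturbed Jacobian and `2 * R` that of the
  -- perturbed one; the projections are Lipschitz with the sum of the two.
  refine ⟨Real.toNNReal (R + 2 * R), ?_⟩
  -- Below this threshold `R * gamma` is at most `1 / 2`, as the stability of the lower bound
  -- requires. The denominator has `R + 1` because `R` may vanish.
  have hpos : (0 : ℝ≥0∞) < ENNReal.ofReal (1 / (2 * (R + 1))) :=
    ENNReal.ofReal_pos.2 (by positivity)
  filter_upwards [hγ.eventually_lt_const hpos] with σ hσ u hu
  -- A priori `gamma` may be infinite; below the threshold it is a genuine number `g`, which can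
  -- serve in real estimates and as a constant in `ℝ≥0`.
  have hfin : gamma M σ ≠ ⊤ := (hσ.trans ENNReal.ofReal_lt_top).ne
  set g := (gamma M σ).toNNReal with hg
  have hgγ : (g : ℝ≥0∞) = gamma M σ := ENNReal.coe_toNNReal hfin
  have hgR : R * g ≤ 1 / 2 := by
    have h1 : (g : ℝ) < 1 / (2 * (R + 1)) := by
      rw [← hgγ, ENNReal.lt_ofReal_iff_toReal_lt ENNReal.coe_ne_top] at hσ
      simpa using hσ
    rw [lt_div_iff₀ (by positivity)] at h1
    nlinarith [g.coe_nonneg]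
  have hjac : ∀ᵐ ζ ∂(volume.restrict (Ω : Set (E d))),
      ‖(M σ).jac ζ - (M 0).jac ζ‖ ≤ g := by
    have h1 := Patch.LInfNorm_jac_sub_le (M 0).toPatch (M σ).toPatch
    rw [LInfNorm, eLpNorm_exponent_top] at h1
    filter_upwards [ae_le_eLpNormEssSup (f := fun ζ => (M σ).jac ζ - (M 0).jac ζ)
      (μ := volume.restrict (Ω : Set (E d)))] with ζ hζ
    have h2 := hζ.trans (h1.trans_eq hgγ.symm)
    rw [enorm_le_coe] at h2
    exact h2
  -- A pointwise bound by a constant multiple of `u` passes at once to `L²` norms.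
  have hae : ∀ᵐ x ∂(M 0).area, ‖normalDiff M σ u x‖₊ ≤
      (Real.toNNReal (R + 2 * R) * g) * ‖Patch.H1.field u x‖₊ := by
    refine (M 0).ae_area.2 ?_
    filter_upwards [hjac, hb, normalDiff_m M σ u, ae_restrict_mem Patch.measurableSet_dom]
      with ζ h1 h2 h3 hζ
    -- The pseudoinverse is a left inverse of the Jacobian, so its norm bound is a lower bound of
    -- the Jacobian.
    have hA : ∀ x, ‖x‖ ≤ R * ‖(M 0).jac ζ x‖ := fun x => by
      have : (M 0).pinv ζ ((M 0).jac ζ x) = x :=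
        congrArg (fun T : E d →L[ℝ] E d => T x) ((M 0).pinv_comp_jac hζ)
      calc ‖x‖ = ‖(M 0).pinv ζ ((M 0).jac ζ x)‖ := by rw [this]
        _ ≤ ‖(M 0).pinv ζ‖ * ‖(M 0).jac ζ x‖ := ContinuousLinearMap.le_opNorm _ _
        _ ≤ R * ‖(M 0).jac ζ x‖ := mul_le_mul_of_nonneg_right h2 (norm_nonneg _)
    rw [norm_sub_rev] at h1
    have hB := norm_le_two_mul_of_norm_sub_le hR hA
      ((mul_le_mul_of_nonneg_left h1 hR).trans hgR)
    have hP := (norm_starProjection_orthogonal_range_sub_le hR (by positivity) hA hB).trans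
      (mul_le_mul_of_nonneg_left h1 (by positivity))
    have hn : ‖normalDiff M σ u ((M 0).m ζ)‖ ≤
        (R + 2 * R) * g * ‖Patch.H1.field u ((M 0).m ζ)‖ := by
      rw [h3]
      exact ContinuousLinearMap.le_of_opNorm_le _ hP _
    rw [← NNReal.coe_le_coe, NNReal.coe_mul, NNReal.coe_mul, Real.coe_toNNReal _ (by positivity)]
    exact hn
  have hfield : eLpNorm (Patch.H1.field u) 2 (M 0).area ≤ 1 := by
    rw [← Lp.enorm_def, ← ofReal_norm]
    exact ENNReal.ofReal_le_one.2 ((Patch.H1.norm_field_le u).trans hu)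
  calc (M 0).L2Norm (normalDiff M σ u)
      ≤ (Real.toNNReal (R + 2 * R) * g : ℝ≥0) • eLpNorm (Patch.H1.field u) 2 (M 0).area :=
        eLpNorm_le_nnreal_smul_eLpNorm_of_ae_le_mul hae 2
    _ ≤ (Real.toNNReal (R + 2 * R) * g : ℝ≥0) • 1 := by gcongr
    _ = Real.toNNReal (R + 2 * R) * gamma M σ := by
      rw [← hgγ, ENNReal.smul_def, smul_eq_mul, mul_one, ENNReal.coe_mul]

/-- The square of `a + b` exceeds `a ^ 2 + b ^ 2` by the cross term, which is nonnegative. This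
separates the two components of the product norm. -/
theorem rpow_half_sq_add_sq_le (a b : ℝ≥0∞) : (a ^ 2 + b ^ 2) ^ (1 / 2 : ℝ) ≤ a + b := by
  calc (a ^ 2 + b ^ 2) ^ (1 / 2 : ℝ) ≤ ((a + b) ^ 2) ^ (1 / 2 : ℝ) := by
        gcongr
        rw [add_sq]
        gcongr
        exact le_self_add
    _ = a + b := by
      rw [← ENNReal.rpow_natCast, ← ENNReal.rpow_mul]
      norm_num

end SurfacePert

/-! ### Both components together: the rate and the convergence -/

theorem mainTheorem8 {d₁ d₂ r : ℕ} {Ω₁ : Opens (E d₁)} {Ω₂ : Opens (E d₂)}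
    (M₁ : ℝ≥0 → W2Patch d₁ Ω₁) (M₂ : ℝ≥0 → Patch d₂ Ω₂)
    (F : ∀ σ : ℝ≥0, (M₁ σ).H1 →L[ℝ] (M₂ σ).L2 r)
    (hρ : Tendsto (rho M₁ M₂ F) (𝓝[>] 0) (𝓝 0))
    (hγ : Tendsto (gamma M₁) (𝓝[>] 0) (𝓝 0)) :
    Tendsto (rhoAmbient M₁ M₂ F) (𝓝[>] 0) (𝓝 0) ∧
      ∃ C : ℝ≥0, ∀ᶠ σ in 𝓝[>] 0, rhoAmbient M₁ M₂ F σ ≤ C * (rho M₁ M₂ F σ + gamma M₁ σ) := by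
  obtain ⟨C, hC⟩ := exists_L2Norm_normalDiff_le M₁ hγ
  -- The coefficient of `rho` is 1 and that of `gamma` is `C`; both are at most `C + 1`. Where `rho`
  -- or `gamma` is infinite the inequality is trivial.
  have key : ∀ᶠ σ in 𝓝[>] 0,
      rhoAmbient M₁ M₂ F σ ≤ ((C + 1 : ℝ≥0) : ℝ≥0∞) * (rho M₁ M₂ F σ + gamma M₁ σ) := by
    filter_upwards [hC] with σ hσ
    -- The set of admissible `σ` does not depend on `u`, so a bound for each `u` in the unit ball
    -- bounds the operator norm.
    refine iSup₂_le fun u hu => ?_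
    have h1 : (M₂ 0).L2Norm (opDiff M₁ M₂ F σ u) ≤ rho M₁ M₂ F σ :=
      le_iSup₂ (f := fun (u : (M₁ 0).H1) (_ : ‖u‖ ≤ 1) =>
        (M₂ 0).L2Norm (opDiff M₁ M₂ F σ u)) u hu
    refine (rpow_half_sq_add_sq_le _ _).trans ((add_le_add h1 (hσ u hu)).trans ?_)
    rw [mul_add]
    push_cast
    refine add_le_add ?_ ?_
    · exact le_mul_of_one_le_left' le_add_self
    · gcongr
      exact le_self_add
  refine ⟨?_, C + 1, key⟩
  refine tendsto_of_tendsto_of_tendsto_of_le_of_le' tendsto_const_nhds ?_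
    (Eventually.of_forall fun _ => zero_le) key
  -- Multiplication by a constant of `[0, ∞]` is continuous at 0 because the constant is finite.
  have := ENNReal.Tendsto.const_mul (hρ.add hγ)
    (Or.inr (ENNReal.coe_ne_top : ((C + 1 : ℝ≥0) : ℝ≥0∞) ≠ ⊤))
  simpa using this
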